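/- Let $d\ge 1$ and $0<q<2<p\le\infty$, and put $$\frac1p+\frac1{p'}=1,\qquad \frac1{p^\sharp}=\Big|\frac12-\frac1p\Big|,\qquad \frac1{q^\sharp}=\Big|\frac12-\frac1q\Big| .$$ For $f\in L^1(\mathbb R^d)$ (complex valued) let $\widehat f(\xi)=\int_{\mathbb R^d}f(x)e^{-2\pi i\langle x,\xi\rangle}\,dx$. There is a finite constant $K$, depending only on $d,p,q$, such that the following holds for all measurable weights $u,v:\mathbb R^d\to[0,\infty]$ and every finite $C\ge 0$ (with the conventions $0\cdot\infty=0$, $0^{-a}=\infty$, $\infty^{-a}=0$ for $a>0$). Assume that $$\|u\widehat f\|_q\le C\,\|fv\|_p\qquad\text{for every } f\in L^1(\mathbb R^d)\text{ with }\|fv\|_p<\infty ,$$ where $\|g\|_q=(\int|g|^q)^{1/q}$, and $\|\cdot\|_\infty$ is the essential supremum. Then: (i) $$\sup_{t>0}\Bigg(\sum_{n\in\mathbb Z^d}\Big(\int_{\frac nt+\frac1t[-\frac12,\frac12]^d}v^{-p'}\Big)^{\frac{p^\sharp}{p'}}\Bigg)^{\frac1{p^\sharp}}\Bigg(\sum_{n\in\mathbb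 Z^d}\Big(\int_{nt+t[-\frac12,\frac12]^d}u^{q}\Big)^{\frac{q^\sharp}{q}}\Bigg)^{\frac1{q^\sharp}}\le K\,C .$$ (ii) For every $t>0$: if $u$ is radial and non-increasing on $\{|x|\ge t/2\}$ and $v^{-1}$ is radial and non-increasing on $\{|x|\ge 1/(2t)\}$, with radial parts $u_0$ and $v_0^{-1}$, that is, $u(x)=u_0(|x|)$ and $v(x)=v_0(|x|)$ on the respective sets, then $$\Big(\int_{1/t}^\infty v_0^{-p^\sharp}(y)\,y^{d-1}\,dy\Big)^{\frac1{p^\sharp}}\Big(\int_t^\infty u_0^{q^\sharp}(\xi)\,\xi^{d-1}\,d\xi\Big)^{\frac1{q^\sharp}}\le K\,C .$$ -/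

import Mathlib

open MeasureTheory Set
open scoped ENNReal NNReal FourierTransform

noncomputable section

/-- The conjugate exponent `p'`, with `1/p + 1/p' = 1`, for `1 < p ≤ ∞` (so `p' = 1` for `p = ∞`). -/
def conjExp (p : ℝ≥0∞) : ℝ := (1 - (p⁻¹).toReal)⁻¹

/-- The exponent `p♯`, with `1/p♯ = |1/2 - 1/p|`, for `0 < p ≤ ∞`, `p ≠ 2` (so `p♯ = 2` for `p = ∞`). -/
def sharpExp (p : ℝ≥0∞) : ℝ := |1 / 2 - (p⁻¹).toReal|⁻¹

/-- The closed cube `s n + s [-1/2, 1/2]^d` in `ℝ^d`. -/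
def gridCube {d : ℕ} (s : ℝ) (n : Fin d → ℤ) : Set (EuclideanSpace ℝ (Fin d)) :=
  {x | ∀ i, |x i - s * n i| ≤ s / 2}

/-- The weighted Fourier inequality `‖u f̂‖_q ≤ C ‖f v‖_p` for all `f ∈ L¹(ℝ^d)`, where
`f̂(ξ) = ∫ f(x) exp(-2πi⟨x, ξ⟩) dx`. There is nothing to check for an `f` with `‖f v‖_p = ∞`
(the explicit restriction matters only for `C = 0`, because of the convention `0 * ∞ = 0`). -/
def WeightedFourierIneq {d : ℕ} (p q : ℝ≥0∞) (u v : EuclideanSpace ℝ (Fin d) → ℝ≥0∞)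
    (C : ℝ≥0) : Prop :=
  ∀ f : EuclideanSpace ℝ (Fin d) → ℂ, Integrable f volume →
    eLpNorm (fun x => ‖f x‖ₑ * v x) p volume < ∞ →
    eLpNorm (fun ξ => u ξ * ‖𝓕 f ξ‖ₑ) q volume
      ≤ C * eLpNorm (fun x => ‖f x‖ₑ * v x) p volume

/-- The amalgam expression `(∑_{n ∈ ℤ^d} (∫_{s n + s [-1/2,1/2]^d} w^a)^{b/|a|})^{1/b}`,
for a real exponent `a ≠ 0` which may be negative. -/
def cubeSum {d : ℕ} (s a b : ℝ) (w : EuclideanSpace ℝ (Fin d) → ℝ≥0∞) : ℝ≥0∞ :=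
  (∑' n : Fin d → ℤ, (∫⁻ x in gridCube s n, w x ^ a) ^ (b / |a|)) ^ (1 / b)

/-- `w` is radial and non-increasing for `|x| ≥ a`, with radial part `w₀` there. -/
def RadialAntitoneBeyond {d : ℕ} (a : ℝ) (w : EuclideanSpace ℝ (Fin d) → ℝ≥0∞)
    (w₀ : ℝ → ℝ≥0∞) : Prop :=
  (∀ x, a ≤ ‖x‖ → w x = w₀ ‖x‖) ∧ AntitoneOn w₀ (Ici a)

/-- The tail expression `(∫_s^∞ w₀(y)^a y^{d-1} dy)^{1/|a|}`, for a real exponent `a ≠ 0`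
which may be negative. -/
def radialTail (d : ℕ) (s a : ℝ) (w₀ : ℝ → ℝ≥0∞) : ℝ≥0∞ :=
  (∫⁻ y in Ioi s, w₀ y ^ a * ENNReal.ofReal (y ^ (d - 1))) ^ (1 / |a|)

end

/-! The inequality is tested on random functions. Take disjoint cells `E n` in space and `D m` in
frequency, small enough that the phase of `⟨x - x₀, ξ - η⟩` barely varies on `E n × D m`. The test
function is `φ · ∑ ε_n 1_{E_n}` times the Riesz product `∏ (1 + i δ_j a_j r_j)`, where the `ε`, `δ`
are signs and the `r_j` are cosines and sines with frequencies `η m`. Since `r_j` is real, each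
factor has modulus at most `exp(a_j² / 2)`, so `∑ a_j² ≤ 2` keeps the test function below `3 |φ|`
for every choice of signs.

For `ξ ∈ D m`, the factor of index `(m, s)` moves the frequency `η m` close to `ξ`. The average over
signs of `|f̂(ξ)|^q` is then at least a constant times `(α_m² T)^{q/2}`, with `T = ∑ (∫_{E_n} φ)²`:
the second moment is bounded below, the fourth above, and interpolation gives the `q`-th moment for
every `0 < q < 2` (`sum_signs_rpow_lower`). Integration over the cells `D m` gives
`sum_lintegral_le`.

It remains to optimise in `φ` and `α` (`finite_family_le`). With `W_n = ∫_{E_n} w^{p'}`, `U_m =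
∫_{D_m} u^q`, `A = ∑ W_n^{p♯/p'}` and `B = ∑ U_m^{q♯/q}`, the extremal choices give `A^{1/2 - 1/p}
B^{1/q - 1/2} ≤ K C`. Truncation and monotone convergence extend this to whole lattices of small
cubes. The coarse cubes of (i) are finite unions of pieces of these. For (ii), a decreasing radial
weight at `x` is dominated by its averages over a nearby cube closer to the origin, and the powers
of `t` lost on the two sides cancel. -/

noncomputable section

/-! ### Second and fourth moments of random sign sums -/

/-- Changing the sign of one coordinate of a vector of signs. -/
def flipSign {J : Type*} [DecidableEq J] (j : J) (δ : J → ℤˣ) : J → ℤˣ :=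
  Function.update δ j (-δ j)

lemma flipSign_involutive {J : Type*} [DecidableEq J] (j : J) :
    Function.Involutive (flipSign j) := by
  intro δ
  simp [flipSign]

lemma flipSign_self {J : Type*} [DecidableEq J] (j : J) (δ : J → ℤˣ) :
    flipSign j δ j = -δ j := by simp [flipSign]

lemma flipSign_of_ne {J : Type*} [DecidableEq J] {i j : J} (h : i ≠ j) (δ : J → ℤˣ) :
    flipSign j δ i = δ i := by simp [flipSign, h]

/-- Pairing `δ` with its flip at `j` averages out the sign `δ j` while `A` and `B` stay fixed. This
replaces conditioning on the other signs in all the moment computations. -/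
lemma two_mul_sum_sign {J : Type*} [Fintype J] [DecidableEq J] (j : J) (A B : (J → ℤˣ) → ℂ)
    (hA : ∀ δ, A (flipSign j δ) = A δ) (hB : ∀ δ, B (flipSign j δ) = B δ) (Φ : ℂ → ℝ) :
    2 * ∑ δ, Φ (A δ + ((δ j : ℤ) : ℂ) * B δ) = ∑ δ, (Φ (A δ + B δ) + Φ (A δ - B δ)) := by
  have h1 : ∑ δ, Φ (A δ + ((δ j : ℤ) : ℂ) * B δ) = ∑ δ, Φ (A δ - ((δ j : ℤ) : ℂ) * B δ) := by
    rw [← Equiv.sum_comp (flipSign_involutive j).toPerm]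
    refine Finset.sum_congr rfl fun δ _ => ?_
    simp only [Function.Involutive.coe_toPerm, hA, hB, flipSign_self]
    congr 1
    push_cast
    ring
  rw [two_mul]
  nth_rewrite 2 [h1]
  rw [← Finset.sum_add_distrib]
  refine Finset.sum_congr rfl fun δ _ => ?_
  rcases Int.units_eq_one_or (δ j) with h | h
  · simp [h]
  · simp only [h]
    push_cast
    rw [add_comm]
    congr 2 <;> ring

lemma sum_sign_flip_invariant {J : Type*} [DecidableEq J] (z : J → ℂ) {T : Finset J} {j : J}
    (hj : j ∉ T) (δ : J → ℤˣ) :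
    ∑ n ∈ T, ((flipSign j δ n : ℤ) : ℂ) * z n = ∑ n ∈ T, ((δ n : ℤ) : ℂ) * z n := by
  refine Finset.sum_congr rfl fun n hn => ?_
  rw [flipSign_of_ne (ne_of_mem_of_not_mem hn hj)]

lemma sum_sign_norm_sq {J : Type*} [Fintype J] [DecidableEq J] (z : J → ℂ) (T : Finset J) :
    ∑ δ : J → ℤˣ, ‖∑ n ∈ T, ((δ n : ℤ) : ℂ) * z n‖ ^ 2
      = Fintype.card (J → ℤˣ) * ∑ n ∈ T, ‖z n‖ ^ 2 := by
  induction T using Finset.induction_on with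
  | empty => simp
  | insert j T hj ih =>
    have h := two_mul_sum_sign j (fun δ => ∑ n ∈ T, ((δ n : ℤ) : ℂ) * z n) (fun _ => z j)
      (sum_sign_flip_invariant z hj) (fun _ => rfl) (fun w => ‖w‖ ^ 2)
    have h2 : ∀ A B : ℂ, ‖A + B‖ ^ 2 + ‖A - B‖ ^ 2 = 2 * ‖A‖ ^ 2 + 2 * ‖B‖ ^ 2 := by
      intro A B
      have := parallelogram_law_with_norm ℝ A B
      nlinarith
    simp only [h2, Finset.sum_add_distrib, ← Finset.mul_sum, ih] at h
    simp only [Finset.sum_insert hj]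
    simp only [add_comm (((_ : ℤˣ) : ℤ) * z j : ℂ)]
    simp only [Finset.sum_const, Finset.card_univ, nsmul_eq_mul] at h
    linarith

/-- The parallelogram law fixes the sum of the two squares, and their product is `‖A² - B²‖² ≥ (‖A‖²
- ‖B‖²)²`; then `x² + y² = (x + y)² - 2xy`. -/
lemma norm_add_pow_four_add_norm_sub_pow_four_le (A B : ℂ) :
    ‖A + B‖ ^ 4 + ‖A - B‖ ^ 4 ≤ 2 * ‖A‖ ^ 4 + 12 * ‖A‖ ^ 2 * ‖B‖ ^ 2 + 2 * ‖B‖ ^ 4 := by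
  have h := parallelogram_law_with_norm ℝ A B
  have e1 : ‖A + B‖ ≤ ‖A‖ + ‖B‖ := norm_add_le _ _
  have e2 := norm_nonneg (A + B)
  have e3 := norm_nonneg (A - B)
  have hp : (‖A + B‖ * ‖A - B‖) ^ 2 ≥ (‖A‖ ^ 2 - ‖B‖ ^ 2) ^ 2 := by
    have : ‖A + B‖ * ‖A - B‖ = ‖A ^ 2 - B ^ 2‖ := by rw [← norm_mul]; congr 1; ring
    rw [this]
    have h3 : |‖A ^ 2‖ - ‖B ^ 2‖| ≤ ‖A ^ 2 - B ^ 2‖ := abs_norm_sub_norm_le _ _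
    rw [norm_pow, norm_pow] at h3
    rw [ge_iff_le, ← sq_abs (‖A‖ ^ 2 - ‖B‖ ^ 2)]
    gcongr
  have h4 : (‖A + B‖ ^ 2 + ‖A - B‖ ^ 2) ^ 2 = (2 * (‖A‖ ^ 2 + ‖B‖ ^ 2)) ^ 2 := by
    rw [show ‖A + B‖ ^ 2 + ‖A - B‖ ^ 2 = 2 * (‖A‖ ^ 2 + ‖B‖ ^ 2) by linarith]
  nlinarith

/-- Khintchine's inequality for the exponent 4. With `S` the sum of squares over `T`, adding `z j`
changes the mean by at most `6 S ‖z j‖² + ‖z j‖⁴`, which is below the increase of `3 S²`. -/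
lemma sum_sign_norm_pow_four_le {J : Type*} [Fintype J] [DecidableEq J] (z : J → ℂ)
    (T : Finset J) :
    ∑ δ : J → ℤˣ, ‖∑ n ∈ T, ((δ n : ℤ) : ℂ) * z n‖ ^ 4
      ≤ Fintype.card (J → ℤˣ) * (3 * (∑ n ∈ T, ‖z n‖ ^ 2) ^ 2) := by
  induction T using Finset.induction_on with
  | empty => simp
  | insert j T hj ih =>
    have h := two_mul_sum_sign j (fun δ => ∑ n ∈ T, ((δ n : ℤ) : ℂ) * z n) (fun _ => z j)
      (sum_sign_flip_invariant z hj) (fun _ => rfl) (fun w => ‖w‖ ^ 4)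
    have h2 := Finset.sum_le_sum (s := Finset.univ) fun (δ : J → ℤˣ) _ =>
      norm_add_pow_four_add_norm_sub_pow_four_le (∑ n ∈ T, ((δ n : ℤ) : ℂ) * z n) (z j)
    rw [← h] at h2
    simp only [Finset.sum_add_distrib, ← Finset.mul_sum, ← Finset.sum_mul, sum_sign_norm_sq] at h2
    simp only [Finset.sum_insert hj]
    simp only [add_comm (((_ : ℤˣ) : ℤ) * z j : ℂ)]
    simp only [Finset.sum_const, Finset.card_univ, nsmul_eq_mul] at h2
    have h5 : 0 ≤ (Fintype.card (J → ℤˣ) : ℝ) * (‖z j‖ ^ 2) ^ 2 := by positivity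
    nlinarith

/-! ### Riesz products with random signs -/

/-- The Riesz product `∏ (1 + i δ_j c_j)`. -/
def rieszProd {J : Type*} [Fintype J] (c : J → ℝ) (δ : J → ℤˣ) : ℂ :=
  ∏ j, (1 + Complex.I * ((δ j : ℤ) : ℂ) * c j)

/-- Each factor has squared modulus `1 + c_j² ≤ exp(c_j²)`, because its perturbation is purely
imaginary; so the squared modulus of the product is at most `e² < 9`. -/
lemma norm_rieszProd_le {J : Type*} [Fintype J] (c : J → ℝ) (δ : J → ℤˣ)
    (hc : ∑ j, c j ^ 2 ≤ 2) : ‖rieszProd c δ‖ ≤ 3 := by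
  have h1 : ‖rieszProd c δ‖ ^ 2 ≤ Real.exp (∑ j, c j ^ 2) := by
    rw [rieszProd, norm_prod, ← Finset.prod_pow, Real.exp_sum]
    refine Finset.prod_le_prod (fun _ _ => by positivity) fun j _ => ?_
    have : ‖(1 + Complex.I * ((δ j : ℤ) : ℂ) * c j)‖ ^ 2 = c j ^ 2 + 1 := by
      rw [← Complex.normSq_eq_norm_sq]
      rcases Int.units_eq_one_or (δ j) with h | h <;> simp [h, Complex.normSq_apply] <;> ring
    rw [this]
    exact Real.add_one_le_exp _
  have h2 : Real.exp (∑ j, c j ^ 2) ≤ 9 := by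
    calc Real.exp (∑ j, c j ^ 2) ≤ Real.exp 2 := Real.exp_le_exp.2 hc
      _ = Real.exp 1 ^ 2 := by rw [← Real.exp_nat_mul]; norm_num
      _ ≤ 3 ^ 2 := by
        have := Real.exp_one_lt_d9
        gcongr
        linarith
      _ = 9 := by norm_num
  nlinarith [norm_nonneg (rieszProd c δ)]

/-- The factors are independent, each of mean 1. -/
lemma sum_rieszProd {J : Type*} [Fintype J] [DecidableEq J] (c : J → ℝ) :
    ∑ δ : J → ℤˣ, rieszProd c δ = Fintype.card (J → ℤˣ) := by
  have h := Finset.prod_univ_sum (fun _ : J => (Finset.univ : Finset ℤˣ))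
    (fun j s => (1 + Complex.I * ((s : ℤ) : ℂ) * c j))
  simp only [Fintype.piFinset_univ] at h
  simp only [rieszProd]
  rw [← h]
  have : ∀ j, ∑ s : ℤˣ, (1 + Complex.I * ((s : ℤ) : ℂ) * c j) = 2 := by
    intro j
    rw [show (Finset.univ : Finset ℤˣ) = {1, -1} from rfl]
    rw [Finset.sum_pair (by decide)]
    push_cast
    ring
  rw [Finset.prod_congr rfl fun j _ => this j]
  simp [Fintype.card_units_int]

lemma rieszProd_eq_update {J : Type*} [Fintype J] [DecidableEq J] (c : J → ℝ) (j : J)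
    (δ : J → ℤˣ) :
    rieszProd c δ = (1 + Complex.I * ((δ j : ℤ) : ℂ) * c j) *
      rieszProd (Function.update c j 0) δ := by
  simp only [rieszProd]
  rw [← Finset.mul_prod_erase _ _ (Finset.mem_univ j),
    ← Finset.mul_prod_erase (a := j) _ (fun i => (1 + Complex.I * ((δ i : ℤ) : ℂ) *
      (Function.update c j 0 i : ℝ))) (Finset.mem_univ j)]
  simp only [Function.update_self, Complex.ofReal_zero, mul_zero, add_zero, one_mul]
  congr 1
  refine Finset.prod_congr rfl fun i hi => ?_
  rw [Function.update_of_ne (Finset.ne_of_mem_erase hi)]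

lemma rieszProd_update_flip {J : Type*} [Fintype J] [DecidableEq J] (c : J → ℝ) (j : J)
    (δ : J → ℤˣ) :
    rieszProd (Function.update c j 0) (flipSign j δ) = rieszProd (Function.update c j 0) δ := by
  simp only [rieszProd]
  refine Finset.prod_congr rfl fun i _ => ?_
  by_cases h : i = j
  · subst h; simp
  · rw [flipSign_of_ne h]

lemma sum_update_zero_sq_le {J : Type*} [Fintype J] [DecidableEq J] (c : J → ℝ) (j : J) :
    ∑ i, Function.update c j 0 i ^ 2 ≤ ∑ i, c i ^ 2 := by
  refine Finset.sum_le_sum fun i _ => ?_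
  by_cases h : i = j
  · subst h; simp [sq_nonneg]
  · rw [Function.update_of_ne h]

/-! ### Lower bounds for low moments -/

/-- Below the threshold `l` the first term dominates, above it the second. -/
lemma sq_le_rpow_add_pow_four {q l y : ℝ} (hq0 : 0 < q) (hq2 : q < 2) (hl : 0 < l) (hy : 0 ≤ y) :
    y ^ 2 ≤ l ^ (2 - q) * y ^ q + y ^ 4 / l ^ 2 := by
  rcases le_total y l with h | h
  · have h0 : 0 ≤ y ^ 4 / l ^ 2 := by positivity
    have h1 : y ^ 2 ≤ l ^ (2 - q) * y ^ q := by
      rcases hy.eq_or_lt with h' | h'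
      · subst h'; simp [Real.zero_rpow hq0.ne']
      · calc y ^ 2 = y ^ (2 - q) * y ^ q := by
              rw [← Real.rpow_add h', ← Real.rpow_natCast]; norm_num
          _ ≤ _ := by gcongr
    linarith
  · have h0 : 0 ≤ l ^ (2 - q) * y ^ q := by positivity
    have h1 : y ^ 2 ≤ y ^ 4 / l ^ 2 := by
      rw [le_div_iff₀ (by positivity)]
      have : l ^ 2 ≤ y ^ 2 := by gcongr
      nlinarith [sq_nonneg y]
    linarith

/-- `2 B` is the difference of `A + B` and `A - B`, so one of these has norm at least `‖B‖`. No
convexity is used, hence every `q > 0` is allowed. -/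
lemma sum_rpow_norm_le_of_flip {J : Type*} [Fintype J] [DecidableEq J] (j : J)
    (A B : (J → ℤˣ) → ℂ) (hA : ∀ δ, A (flipSign j δ) = A δ) (hB : ∀ δ, B (flipSign j δ) = B δ)
    {q : ℝ} (hq : 0 < q) :
    ∑ δ, ‖B δ‖ ^ q ≤ 2 * ∑ δ, ‖A δ + ((δ j : ℤ) : ℂ) * B δ‖ ^ q := by
  rw [two_mul_sum_sign j A B hA hB (fun w => ‖w‖ ^ q)]
  refine Finset.sum_le_sum fun δ _ => ?_
  have h : ‖B δ‖ ≤ max ‖A δ + B δ‖ ‖A δ - B δ‖ := by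
    have h1 : ‖(2 : ℂ) * B δ‖ ≤ ‖A δ + B δ‖ + ‖A δ - B δ‖ := by
      rw [show (2 : ℂ) * B δ = (A δ + B δ) - (A δ - B δ) by ring]
      exact norm_sub_le _ _
    rw [norm_mul, Complex.norm_ofNat] at h1
    have := le_max_left ‖A δ + B δ‖ ‖A δ - B δ‖
    have := le_max_right ‖A δ + B δ‖ ‖A δ - B δ‖
    linarith
  have h1 : 0 ≤ ‖A δ + B δ‖ ^ q := by positivity
  have h2 : 0 ≤ ‖A δ - B δ‖ ^ q := by positivity
  rcases le_max_iff.1 h with h | h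
  · have := Real.rpow_le_rpow (norm_nonneg _) h hq.le
    linarith
  · have := Real.rpow_le_rpow (norm_nonneg _) h hq.le
    linarith

/-- The constant in the lower bound for the moments of randomized Fourier transforms. -/
def momentConst (q : ℝ) : ℝ := ((7776 : ℝ) ^ ((2 - q) / 2))⁻¹ / 64

lemma momentConst_pos (q : ℝ) : 0 < momentConst q := by
  unfold momentConst; positivity

/-- If a nonnegative function on a finite set has second moment at least `S / 16` and fourth moment
at most `243 S ^ 2`, then its `q`-th moment is bounded below. -/
lemma moment_lower_bound {Ω : Type*} (s : Finset Ω) (y : Ω → ℝ) (hy : ∀ i, 0 ≤ y i) {q S κ : ℝ}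
    (hq0 : 0 < q) (hq2 : q < 2) (hS : 0 ≤ S)
    (h2 : κ * (S / 16) ≤ ∑ i ∈ s, y i ^ 2) (h4 : ∑ i ∈ s, y i ^ 4 ≤ κ * (243 * S ^ 2)) :
    κ * (2 * momentConst q * S ^ (q / 2)) ≤ ∑ i ∈ s, y i ^ q := by
  rcases hS.eq_or_lt with h0 | h0
  · subst h0
    rw [Real.zero_rpow (by positivity)]
    simp only [mul_zero]
    exact Finset.sum_nonneg fun i _ => Real.rpow_nonneg (hy i) _
  -- `7776 = 32 · 243`: the fourth moment then accounts for at most `S / 32`, half of the second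
  -- moment.
  set l : ℝ := (7776 * S) ^ (1 / 2 : ℝ) with hl
  have hlpos : 0 < l := by positivity
  have hl2 : l ^ 2 = 7776 * S := by
    rw [hl, ← Real.rpow_natCast, ← Real.rpow_mul (by positivity)]; norm_num
  have h := Finset.sum_le_sum (s := s) fun i _ => sq_le_rpow_add_pow_four hq0 hq2 hlpos (hy i)
  rw [Finset.sum_add_distrib, ← Finset.mul_sum, ← Finset.sum_div] at h
  have h5 : (∑ i ∈ s, y i ^ 4) / l ^ 2 ≤ κ * (S / 32) := by
    rw [div_le_iff₀ (by positivity), hl2]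
    nlinarith
  have h6 : κ * (S / 32) ≤ l ^ (2 - q) * ∑ i ∈ s, y i ^ q := by nlinarith
  have h7 : l ^ (2 - q) = 7776 ^ ((2 - q) / 2) * S ^ ((2 - q) / 2) := by
    rw [hl, ← Real.rpow_mul (by positivity), Real.mul_rpow (by norm_num) hS]
    congr 2 <;> ring
  have h8 : S ^ ((2 - q) / 2) * S ^ (q / 2) = S := by
    rw [← Real.rpow_add h0]
    ring_nf
    simp
  have h9 : κ * (2 * momentConst q * S ^ (q / 2)) = (l ^ (2 - q))⁻¹ * (κ * (S / 32)) := by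
    rw [h7, momentConst]
    have : 0 < S ^ ((2 - q) / 2) := by positivity
    have : (0 : ℝ) < 7776 ^ ((2 - q) / 2) := by positivity
    field_simp
    linear_combination 64 * κ * h8
  rw [h9, inv_mul_le_iff₀ (by positivity)]
  exact h6

/-! ### Moments of randomized integrals -/

section
variable {X : Type*} [MeasurableSpace X] {J : Type*} [Fintype J]

lemma measurable_rieszProd {c : J → X → ℝ} (hc : ∀ j, Measurable (c j)) (δ : J → ℤˣ) :
    Measurable fun x => rieszProd (fun j => c j x) δ := by
  unfold rieszProd
  refine Finset.measurable_fun_prod _ fun j _ => ?_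
  exact measurable_const.add (measurable_const.mul (Complex.measurable_ofReal.comp (hc j)))

lemma integrable_mul_of_norm_le {μ : Measure X} {κ g : X → ℂ} (hκ : Integrable κ μ)
    (hg : Measurable g) {M : ℝ} (hM : ∀ x, ‖g x‖ ≤ M) : Integrable (fun x => κ x * g x) μ :=
  hκ.mul_bdd hg.aestronglyMeasurable (Filter.Eventually.of_forall hM)

lemma norm_integral_mul_le_of_norm_le {μ : Measure X} {κ g : X → ℂ} (hκ : Integrable κ μ)
    {M : ℝ} (hM : ∀ x, ‖g x‖ ≤ M) :
    ‖∫ x, κ x * g x ∂μ‖ ≤ M * ∫ x, ‖κ x‖ ∂μ := by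
  rw [← integral_const_mul]
  refine norm_integral_le_of_norm_le (hκ.norm.const_mul M) (Filter.Eventually.of_forall fun x => ?_)
  rw [norm_mul, mul_comm]
  exact mul_le_mul_of_nonneg_right (hM x) (norm_nonneg _)

lemma sum_mul_sq_le_of_abs_le {a r : J → ℝ} (ha : ∑ j, a j ^ 2 ≤ 2) (hr : ∀ j, |r j| ≤ 1) :
    ∑ j, (a j * r j) ^ 2 ≤ 2 := by
  refine le_trans (Finset.sum_le_sum fun j _ => ?_) ha
  have := (sq_le_one_iff_abs_le_one (r j)).2 (hr j)
  rw [mul_pow]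
  nlinarith [sq_nonneg (a j)]

/-- Lower bound for the `q`-th moment of a randomized integral against random Riesz products. -/
lemma sum_signs_rpow_lower {ι : Type*} [Fintype ι] [DecidableEq ι] [DecidableEq J]
    {μ : Measure X} {κ : ι → X → ℂ} (hκ : ∀ n, Integrable (κ n) μ)
    {r : J → X → ℝ} (hrm : ∀ j, Measurable (r j)) (hr : ∀ j x, |r j x| ≤ 1)
    {a : J → ℝ} (ha : ∑ j, a j ^ 2 ≤ 2) {q : ℝ} (hq0 : 0 < q) (hq2 : q < 2) {T : ℝ}
    (hT : ∑ n, (∫ x, ‖κ n x‖ ∂μ) ^ 2 ≤ T) (j₀ : J)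
    (hj : T / 16 ≤ ∑ n, ‖∫ x, κ n x * r j₀ x ∂μ‖ ^ 2) :
    (Fintype.card (ι → ℤˣ) : ℝ) * Fintype.card (J → ℤˣ)
        * (momentConst q * (a j₀ ^ 2 * T) ^ (q / 2))
      ≤ ∑ ε : ι → ℤˣ, ∑ δ : J → ℤˣ,
        ‖∑ n, ((ε n : ℤ) : ℂ) * ∫ x, κ n x * rieszProd (fun j => a j * r j x) δ ∂μ‖ ^ q := by
  have hT0 : 0 ≤ T := le_trans (Finset.sum_nonneg fun n _ => sq_nonneg _) hT
  -- The Riesz product without its factor `j₀`: independent of the sign `δ j₀`, still bounded by 3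
  -- and of mean 1.
  set P : (J → ℤˣ) → X → ℂ :=
    fun δ x => rieszProd (Function.update (fun j => a j * r j x) j₀ 0) δ with hP
  have hPm : ∀ δ, Measurable (P δ) := by
    intro δ
    have : P δ = fun x => rieszProd (fun j => Function.update (fun j => fun x => a j * r j x) j₀
        (fun _ => 0) j x) δ := by
      funext x
      simp only [hP]
      congr 1
      funext j
      by_cases h : j = j₀
      · subst h; simp
      · simp [h]
    rw [this]
    refine measurable_rieszProd (fun j => ?_) δ
    by_cases h : j = j₀
    · subst h; simp
    · simpa [h] using (hrm j).const_mul (a j)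
  have hPb : ∀ δ x, ‖P δ x‖ ≤ 3 := fun δ x => norm_rieszProd_le _ _
    ((sum_update_zero_sq_le _ _).trans (sum_mul_sq_le_of_abs_le ha fun j => hr j x))
  have hrPm : ∀ δ, Measurable fun x => (r j₀ x : ℂ) * P δ x := fun δ =>
    (Complex.measurable_ofReal.comp (hrm j₀)).mul (hPm δ)
  have hrPb : ∀ δ x, ‖(r j₀ x : ℂ) * P δ x‖ ≤ 3 := by
    intro δ x
    rw [norm_mul, Complex.norm_real, Real.norm_eq_abs]
    nlinarith [hPb δ x, hr j₀ x, norm_nonneg (P δ x), abs_nonneg (r j₀ x)]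
  -- The coefficient of `δ j₀`. Only this part of the integral is kept in the lower bound.
  set y : ι → (J → ℤˣ) → ℂ :=
    fun n δ => Complex.I * a j₀ * ∫ x, κ n x * ((r j₀ x : ℂ) * P δ x) ∂μ with hy
  have hsplit : ∀ n δ, ∫ x, κ n x * rieszProd (fun j => a j * r j x) δ ∂μ
      = (∫ x, κ n x * P δ x ∂μ) + ((δ j₀ : ℤ) : ℂ) * y n δ := by
    intro n δ
    simp only [hy]
    rw [← integral_const_mul, ← integral_const_mul, ← integral_add]
    · congr 1
      funext x
      rw [rieszProd_eq_update _ j₀]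
      simp only [hP]
      push_cast
      ring
    · exact integrable_mul_of_norm_le (hκ n) (hPm δ) (hPb δ)
    · exact ((integrable_mul_of_norm_le (hκ n) (hrPm δ) (hrPb δ)).const_mul _).const_mul _
  have hPflip : ∀ δ, P (flipSign j₀ δ) = P δ := fun δ => funext fun x => rieszProd_update_flip _ _ _
  set B : (ι → ℤˣ) → (J → ℤˣ) → ℂ := fun ε δ => ∑ n, ((ε n : ℤ) : ℂ) * y n δ with hB
  have hBle : ∀ ε, ∑ δ, ‖B ε δ‖ ^ q ≤ 2 * ∑ δ : J → ℤˣ,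
      ‖∑ n, ((ε n : ℤ) : ℂ) * ∫ x, κ n x * rieszProd (fun j => a j * r j x) δ ∂μ‖ ^ q := by
    intro ε
    refine (sum_rpow_norm_le_of_flip j₀ (fun δ => ∑ n, ((ε n : ℤ) : ℂ) * ∫ x, κ n x * P δ x ∂μ)
      (B ε) ?_ ?_ hq0).trans_eq ?_
    · intro δ; simp only [hPflip]
    · intro δ; simp only [hB, hy, hPflip]
    · congr 1
      refine Finset.sum_congr rfl fun δ _ => ?_
      congr 2
      simp only [hsplit, hB, Finset.mul_sum, ← Finset.sum_add_distrib]
      refine Finset.sum_congr rfl fun n _ => ?_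
      ring
  have hyb : ∀ n δ, ‖y n δ‖ ^ 2 ≤ a j₀ ^ 2 * 9 * (∫ x, ‖κ n x‖ ∂μ) ^ 2 := by
    intro n δ
    have h := norm_integral_mul_le_of_norm_le (hκ n) (hrPb δ)
    simp only [hy]
    rw [norm_mul, norm_mul, Complex.norm_I, one_mul, Complex.norm_real, mul_pow, Real.norm_eq_abs,
      sq_abs, mul_assoc]
    refine mul_le_mul_of_nonneg_left ?_ (sq_nonneg _)
    calc _ ≤ (3 * ∫ x, ‖κ n x‖ ∂μ) ^ 2 := by gcongr
      _ = _ := by ring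
  have hysum : ∀ n, ∑ δ, y n δ
      = Fintype.card (J → ℤˣ) * (Complex.I * a j₀ * ∫ x, κ n x * r j₀ x ∂μ) := by
    intro n
    simp only [hy]
    rw [← Finset.mul_sum, ← integral_finsetSum _ fun δ _ =>
      integrable_mul_of_norm_le (hκ n) (hrPm δ) (hrPb δ)]
    have : ∀ x, ∑ δ, κ n x * ((r j₀ x : ℂ) * P δ x)
        = Fintype.card (J → ℤˣ) * (κ n x * r j₀ x) := by
      intro x
      rw [← Finset.mul_sum, ← Finset.mul_sum]
      simp only [hP]
      rw [sum_rieszProd]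
      ring
    simp only [this]
    rw [integral_const_mul]
    ring
  have hJ : 0 < (Fintype.card (J → ℤˣ) : ℝ) := by exact_mod_cast Fintype.card_pos
  have hylow : ∀ n, Fintype.card (J → ℤˣ) * (a j₀ ^ 2 * ‖∫ x, κ n x * r j₀ x ∂μ‖ ^ 2)
      ≤ ∑ δ, ‖y n δ‖ ^ 2 := by
    intro n
    -- By Cauchy–Schwarz the second moment over `δ` is at least the squared mean, which is explicit
    -- because `P` has mean 1.
    have h1 : ‖∑ δ, y n δ‖ ^ 2 ≤ Fintype.card (J → ℤˣ) * ∑ δ, ‖y n δ‖ ^ 2 :=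
      (pow_le_pow_left₀ (norm_nonneg _) (norm_sum_le _ _) 2).trans sq_sum_le_card_mul_sum_sq
    rw [hysum, norm_mul, norm_mul, norm_mul, Complex.norm_I, Complex.norm_real, Complex.norm_natCast,
      one_mul, mul_pow, mul_pow, Real.norm_eq_abs, sq_abs, sq, mul_assoc] at h1
    exact le_of_mul_le_mul_left h1 hJ
  have hmom := moment_lower_bound (Finset.univ : Finset ((ι → ℤˣ) × (J → ℤˣ)))
    (fun i => ‖B i.1 i.2‖) (fun _ => norm_nonneg _) (q := q) (S := a j₀ ^ 2 * T)
    (κ := (Fintype.card (ι → ℤˣ) : ℝ) * Fintype.card (J → ℤˣ)) hq0 hq2 (by positivity) ?_ ?_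
  · rw [Fintype.sum_prod_type] at hmom
    have := Finset.sum_le_sum fun ε (_ : ε ∈ Finset.univ) => hBle ε
    rw [← Finset.mul_sum] at this
    simp only at hmom
    linarith
  · rw [Fintype.sum_prod_type_right]
    simp only [hB, sum_sign_norm_sq, ← Finset.mul_sum]
    rw [mul_assoc]
    refine mul_le_mul_of_nonneg_left ?_ (Nat.cast_nonneg _)
    rw [Finset.sum_comm]
    refine le_trans ?_ (Finset.sum_le_sum fun n _ => hylow n)
    rw [← Finset.mul_sum, ← Finset.mul_sum, mul_div_assoc]
    gcongr
  · rw [Fintype.sum_prod_type_right]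
    refine (Finset.sum_le_sum fun δ _ => sum_sign_norm_pow_four_le (fun n => y n δ) _).trans ?_
    rw [← Finset.mul_sum, mul_assoc]
    refine mul_le_mul_of_nonneg_left ?_ (Nat.cast_nonneg _)
    rw [← nsmul_eq_mul, ← Finset.card_univ]
    refine Finset.sum_le_card_nsmul _ _ _ fun δ _ => ?_
    have h1 : ∑ n, ‖y n δ‖ ^ 2 ≤ a j₀ ^ 2 * 9 * T := by
      refine (Finset.sum_le_sum fun n _ => hyb n δ).trans ?_
      rw [← Finset.mul_sum]
      gcongr
    -- `243 = 3 · 9²`: 3 from Khintchine, 9 from the square of the bound 3 on `P`.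
    calc 3 * (∑ n, ‖y n δ‖ ^ 2) ^ 2 ≤ 3 * (a j₀ ^ 2 * 9 * T) ^ 2 := by gcongr
      _ = _ := by ring

end

/-! ### Characters and their real modulations -/

/-- The character `exp (-2πi ⟨x, ζ⟩)`. -/
def fourierPhase {V : Type*} [NormedAddCommGroup V] [InnerProductSpace ℝ V] (ζ x : V) : ℂ :=
  Complex.exp ((-2 * Real.pi * inner ℝ x ζ : ℝ) * Complex.I)

section
variable {V : Type*} [NormedAddCommGroup V] [InnerProductSpace ℝ V]

lemma norm_fourierPhase (ζ x : V) : ‖fourierPhase ζ x‖ = 1 := Complex.norm_exp_ofReal_mul_I _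

lemma continuous_fourierPhase (ζ : V) : Continuous (fourierPhase ζ) := by
  unfold fourierPhase; fun_prop

/-- The real and imaginary parts of the character of frequency `η`. -/
def trigPart (η : V) (s : Bool) (x : V) : ℝ :=
  cond s (Real.sin (2 * Real.pi * inner ℝ x η)) (Real.cos (2 * Real.pi * inner ℝ x η))

lemma abs_trigPart_le (η : V) (s : Bool) (x : V) : |trigPart η s x| ≤ 1 := by
  cases s
  · exact Real.abs_cos_le_one _
  · exact Real.abs_sin_le_one _

/-- Riesz factors need real modulations; cosine and sine together recover the frequency shift by
`η`. -/
lemma trigPart_add_I_mul (η ξ x : V) :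
    fourierPhase ξ x * ((trigPart η false x : ℂ) + Complex.I * trigPart η true x)
      = fourierPhase (ξ - η) x := by
  simp only [trigPart, fourierPhase, cond_true, cond_false]
  rw [Complex.ofReal_cos, Complex.ofReal_sin, mul_comm Complex.I, ← Complex.exp_mul_I,
    ← Complex.exp_add]
  congr 1
  rw [inner_sub_right]
  push_cast
  ring

variable [MeasurableSpace V] [BorelSpace V]

lemma integrable_mul_fourierPhase {μ : Measure V} {f : V → ℂ} (hf : Integrable f μ) (ζ : V) :
    Integrable (fun x => f x * fourierPhase ζ x) μ :=
  hf.mul_bdd (c := 1) (continuous_fourierPhase ζ).measurable.aestronglyMeasurable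
    (Filter.Eventually.of_forall fun x => (norm_fourierPhase ζ x).le)

/-- The Fourier transform of a nonnegative function at a frequency for which the phase varies
little on its support. -/
lemma half_integral_le_norm_integral_fourierPhase {μ : Measure V} {φ : V → ℝ} (h0 : ∀ x, 0 ≤ φ x)
    {E : Set V} (hE : MeasurableSet E) (hφ : IntegrableOn φ E μ) (x₀ ζ : V)
    (hx : ∀ x ∈ E, |inner ℝ (x - x₀) ζ| ≤ 1 / 6) :
    (∫ x in E, φ x ∂μ) / 2 ≤ ‖∫ x in E, (φ x : ℂ) * fourierPhase ζ x ∂μ‖ := by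
  have hint : Integrable (fun x => (φ x : ℂ) * fourierPhase ζ x) (μ.restrict E) :=
    integrable_mul_fourierPhase hφ.ofReal ζ
  -- Recentring at `x₀` costs only a unimodular constant.
  have hs : ∀ x, fourierPhase ζ (x - x₀) = fourierPhase ζ (-x₀) * fourierPhase ζ x := by
    intro x
    simp only [fourierPhase]
    rw [← Complex.exp_add]
    congr 1
    rw [inner_sub_left, inner_neg_left]
    push_cast
    ring
  calc (∫ x in E, φ x ∂μ) / 2 = ∫ x in E, φ x / 2 ∂μ := (integral_div _ _).symm
    _ ≤ ∫ x in E, ((φ x : ℂ) * fourierPhase ζ (x - x₀)).re ∂μ := by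
      refine setIntegral_mono_on (hφ.div_const 2) ?_ hE fun x hxE => ?_
      · have : Integrable (fun x => (φ x : ℂ) * fourierPhase ζ (x - x₀)) (μ.restrict E) := by
          simp only [hs]
          convert hint.const_mul (fourierPhase ζ (-x₀)) using 2
          ring
        exact this.re
      · rw [Complex.re_ofReal_mul, fourierPhase, Complex.exp_ofReal_mul_I_re, div_eq_mul_inv]
        refine mul_le_mul_of_nonneg_left ?_ (h0 x)
        -- The bound `1/6` keeps the angle within `π/3`, where the cosine is at least `1/2`.
        rw [← Real.cos_abs, show (2 : ℝ)⁻¹ = Real.cos (Real.pi / 3) by rw [Real.cos_pi_div_three]; ring]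
        refine Real.cos_le_cos_of_nonneg_of_le_pi (abs_nonneg _) (by linarith [Real.pi_pos]) ?_
        rw [abs_mul, abs_mul, abs_of_pos Real.pi_pos]
        have := hx x hxE
        norm_num
        nlinarith [Real.pi_pos]
    _ = (∫ x in E, (φ x : ℂ) * fourierPhase ζ (x - x₀) ∂μ).re := by
      refine (integral_re (f := fun x => (φ x : ℂ) * fourierPhase ζ (x - x₀)) ?_)
      simp only [hs]
      convert hint.const_mul (fourierPhase ζ (-x₀)) using 2
      ring
    _ ≤ ‖∫ x in E, (φ x : ℂ) * fourierPhase ζ (x - x₀) ∂μ‖ := Complex.re_le_norm _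
    _ = ‖∫ x in E, (φ x : ℂ) * fourierPhase ζ x ∂μ‖ := by
      have : ∀ x, (φ x : ℂ) * fourierPhase ζ (x - x₀)
          = fourierPhase ζ (-x₀) * ((φ x : ℂ) * fourierPhase ζ x) := by
        intro x; rw [hs]; ring
      simp only [this]
      rw [integral_const_mul, norm_mul, norm_fourierPhase, one_mul]

lemma measurable_trigPart (η : V) (s : Bool) : Measurable (trigPart η s) := by
  refine Continuous.measurable ?_
  cases s <;> unfold trigPart <;> simp only [cond_true, cond_false] <;> fun_prop

/-- The frequency `ξ - η` is nearly constant in phase on each `E n`, so half of `∫ φ` survives in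
the sum of the cosine and sine parts. Squaring gives `1/8` for the two squares together, and one
part carries half of the total over `n`. The same `s` serves all `n`, but it may depend on `ξ`. -/
lemma exists_trigPart_lower {ι : Type*} [Fintype ι] {μ : Measure V} {φ : V → ℝ}
    (h0 : ∀ x, 0 ≤ φ x) (hφ : Integrable φ μ) {E : ι → Set V} (hE : ∀ n, MeasurableSet (E n))
    (x₀ : ι → V) (ξ η : V) (hx : ∀ n, ∀ x ∈ E n, |inner ℝ (x - x₀ n) (ξ - η)| ≤ 1 / 6) :
    ∃ s : Bool, (∑ n, (∫ x in E n, φ x ∂μ) ^ 2) / 16 ≤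
      ∑ n, ‖∫ x in E n, (φ x : ℂ) * fourierPhase ξ x * trigPart η s x ∂μ‖ ^ 2 := by
  have key : ∀ n, (∫ x in E n, φ x ∂μ) ^ 2 / 8 ≤
      ‖∫ x in E n, (φ x : ℂ) * fourierPhase ξ x * trigPart η false x ∂μ‖ ^ 2 +
      ‖∫ x in E n, (φ x : ℂ) * fourierPhase ξ x * trigPart η true x ∂μ‖ ^ 2 := by
    intro n
    have h := half_integral_le_norm_integral_fourierPhase h0 (hE n) hφ.integrableOn (x₀ n) (ξ - η)
      (hx n)
    have hi : ∀ s, Integrable (fun x => (φ x : ℂ) * fourierPhase ξ x * trigPart η s x)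
        (μ.restrict (E n)) := fun s =>
      integrable_mul_of_norm_le (M := 1) (integrable_mul_fourierPhase hφ.integrableOn.ofReal ξ)
        (Complex.measurable_ofReal.comp (measurable_trigPart η s)) fun x => by
          rw [Complex.norm_real]; exact abs_trigPart_le η s x
    have he : ∫ x in E n, (φ x : ℂ) * fourierPhase (ξ - η) x ∂μ
        = (∫ x in E n, (φ x : ℂ) * fourierPhase ξ x * trigPart η false x ∂μ)
          + Complex.I * ∫ x in E n, (φ x : ℂ) * fourierPhase ξ x * trigPart η true x ∂μ := by
      rw [← integral_const_mul, ← integral_add (hi false) ((hi true).const_mul _)]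
      congr 1
      funext x
      rw [← trigPart_add_I_mul]
      ring
    rw [he] at h
    have h2 := h.trans (norm_add_le _ _)
    rw [norm_mul, Complex.norm_I, one_mul] at h2
    have h3 : 0 ≤ ∫ x in E n, φ x ∂μ := integral_nonneg h0
    set A := ‖∫ x in E n, (φ x : ℂ) * fourierPhase ξ x * trigPart η false x ∂μ‖
    set B := ‖∫ x in E n, (φ x : ℂ) * fourierPhase ξ x * trigPart η true x ∂μ‖
    nlinarith [sq_nonneg (A - B)]
  have hs := Finset.sum_le_sum fun n (_ : n ∈ Finset.univ) => key n
  rw [← Finset.sum_div, Finset.sum_add_distrib] at hs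
  by_contra! hcon
  have := hcon false
  have := hcon true
  linarith

end

/-! ### Randomized test functions -/

section
variable {d : ℕ}

/-- The randomized test function `φ · ∑ ε_n 1_{E_n} · ∏ (1 + i δ_j a_j r_j)`. -/
def testFun {ι J : Type*} [Fintype ι] [Fintype J] (φ : EuclideanSpace ℝ (Fin d) → ℝ) (E : ι → Set (EuclideanSpace ℝ (Fin d))) (r : J → EuclideanSpace ℝ (Fin d) → ℝ)
    (a : J → ℝ) (ε : ι → ℤˣ) (δ : J → ℤˣ) (x : EuclideanSpace ℝ (Fin d)) : ℂ :=
  (∑ n, ((ε n : ℤ) : ℂ) * (E n).indicator (fun x => (φ x : ℂ)) x)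
    * rieszProd (fun j => a j * r j x) δ

section testFun
variable {ι J : Type*} [Fintype ι] [Fintype J] {φ : EuclideanSpace ℝ (Fin d) → ℝ} {E : ι → Set (EuclideanSpace ℝ (Fin d))}
  {r : J → EuclideanSpace ℝ (Fin d) → ℝ} {a : J → ℝ}

lemma integrable_testFun (hφ : Integrable φ volume) (hE : ∀ n, MeasurableSet (E n))
    (hrm : ∀ j, Measurable (r j)) (hr : ∀ j x, |r j x| ≤ 1)
    (ha : ∑ j, a j ^ 2 ≤ 2) (ε : ι → ℤˣ) (δ : J → ℤˣ) :
    Integrable (testFun φ E r a ε δ) volume := by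
  unfold testFun
  refine integrable_mul_of_norm_le (M := 3) ?_
    (measurable_rieszProd (fun j => (hrm j).const_mul (a j)) δ)
    fun x => norm_rieszProd_le _ _ (sum_mul_sq_le_of_abs_le ha fun j => hr j x)
  exact integrable_finsetSum _ fun n _ => (hφ.ofReal.indicator (hE n)).const_mul _

lemma norm_testFun_le (hd : Pairwise (Function.onFun Disjoint E)) (hr : ∀ j x, |r j x| ≤ 1)
    (ha : ∑ j, a j ^ 2 ≤ 2) (ε : ι → ℤˣ) (δ : J → ℤˣ) (x : EuclideanSpace ℝ (Fin d)) :
    ‖testFun φ E r a ε δ x‖ ≤ 3 * ‖φ x‖ := by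
  classical
  unfold testFun
  rw [norm_mul, mul_comm]
  refine mul_le_mul (norm_rieszProd_le _ _ (sum_mul_sq_le_of_abs_le ha fun j => hr j x)) ?_
    (norm_nonneg _) (by norm_num)
  by_cases h : ∃ n, x ∈ E n
  · obtain ⟨n, hn⟩ := h
    rw [Finset.sum_eq_single n]
    · rw [indicator_of_mem hn, norm_mul, Complex.norm_real]
      rcases Int.units_eq_one_or (ε n) with h | h <;> simp [h]
    · intro m _ hm
      rw [indicator_of_notMem, mul_zero]
      exact fun hxm => (Set.disjoint_left.1 (hd hm) hxm) hn
    · simp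
  · push Not at h
    rw [Finset.sum_eq_zero]
    · simp
    · intro n _
      rw [indicator_of_notMem (h n), mul_zero]

lemma fourier_testFun (hφ : Integrable φ volume) (hE : ∀ n, MeasurableSet (E n))
    (hrm : ∀ j, Measurable (r j)) (hr : ∀ j x, |r j x| ≤ 1)
    (ha : ∑ j, a j ^ 2 ≤ 2) (ε : ι → ℤˣ) (δ : J → ℤˣ) (ξ : EuclideanSpace ℝ (Fin d)) :
    𝓕 (testFun φ E r a ε δ) ξ = ∑ n, ((ε n : ℤ) : ℂ) *
      ∫ x, (E n).indicator (fun x => (φ x : ℂ) * fourierPhase ξ x) x *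
        rieszProd (fun j => a j * r j x) δ := by
  rw [Real.fourier_eq']
  have h1 : ∀ n, Integrable (fun x => (E n).indicator (fun x => (φ x : ℂ) * fourierPhase ξ x) x *
        rieszProd (fun j => a j * r j x) δ) volume := fun n =>
    integrable_mul_of_norm_le (M := 3) ((integrable_mul_fourierPhase hφ.ofReal ξ).indicator (hE n))
      (measurable_rieszProd (fun j => (hrm j).const_mul (a j)) δ)
      fun x => norm_rieszProd_le _ _ (sum_mul_sq_le_of_abs_le ha fun j => hr j x)
  simp only [← integral_const_mul]
  rw [← integral_finsetSum _ fun n _ => (h1 n).const_mul _]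
  congr 1
  funext x
  rw [testFun, smul_eq_mul, Finset.sum_mul, Finset.mul_sum]
  refine Finset.sum_congr rfl fun n _ => ?_
  by_cases hx : x ∈ E n
  · simp only [indicator_of_mem hx, fourierPhase]
    ring
  · simp only [indicator_of_notMem hx]
    ring

end testFun

/-- Testing a weighted Fourier inequality against randomized functions. -/
lemma WeightedFourierIneq.sum_lintegral_le {p q : ℝ≥0∞} (hq0 : 0 < q) (hq2 : q < 2)
    {u v : EuclideanSpace ℝ (Fin d) → ℝ≥0∞} (hu : AEMeasurable u volume) {C : ℝ≥0}
    (h : WeightedFourierIneq p q u v C)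
    {ι M : Type*} [Fintype ι] [Fintype M] {φ : EuclideanSpace ℝ (Fin d) → ℝ} (h0 : ∀ x, 0 ≤ φ x)
    (hφ : Integrable φ volume) (hφv : eLpNorm (fun x => ‖φ x‖ₑ * v x) p volume < ∞)
    {E : ι → Set (EuclideanSpace ℝ (Fin d))} (hE : ∀ n, MeasurableSet (E n)) (hEd : Pairwise (Function.onFun Disjoint E))
    {D : M → Set (EuclideanSpace ℝ (Fin d))} (hD : ∀ m, MeasurableSet (D m)) (hDd : Pairwise (Function.onFun Disjoint D))
    (x₀ : ι → EuclideanSpace ℝ (Fin d)) (η : M → EuclideanSpace ℝ (Fin d))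
    (hx : ∀ n m, ∀ x ∈ E n, ∀ ξ ∈ D m, |inner ℝ (x - x₀ n) (ξ - η m)| ≤ 1 / 6)
    {α : M → ℝ} (hα : ∑ m, α m ^ 2 ≤ 1) :
    ∑ m, (∫⁻ ξ in D m, u ξ ^ q.toReal) * ENNReal.ofReal (momentConst q.toReal *
        (α m ^ 2 * ∑ n, (∫ x in E n, φ x) ^ 2) ^ (q.toReal / 2))
      ≤ (C * (3 * eLpNorm (fun x => ‖φ x‖ₑ * v x) p volume)) ^ q.toReal := by
  classical
  set ρ := q.toReal with hρ
  have hqtop : q ≠ ∞ := (hq2.trans ENNReal.ofNat_lt_top).ne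
  have hρ0 : 0 < ρ := ENNReal.toReal_pos hq0.ne' hqtop
  have hρ2 : ρ < 2 := by
    have := (ENNReal.toReal_lt_toReal hqtop ENNReal.ofNat_ne_top).2 hq2
    simpa using this
  set r : M × Bool → EuclideanSpace ℝ (Fin d) → ℝ := fun j => trigPart (η j.1) j.2 with hr_def
  -- Each frequency occurs twice, as cosine and as sine, which turns `∑ α² ≤ 1` into `∑ a² ≤ 2`.
  set a : M × Bool → ℝ := fun j => α j.1 with ha_def
  have hrm : ∀ j, Measurable (r j) := fun j => measurable_trigPart _ _
  have hr : ∀ j x, |r j x| ≤ 1 := fun j x => abs_trigPart_le _ _ _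
  have ha : ∑ j, a j ^ 2 ≤ 2 := by
    rw [Fintype.sum_prod_type]
    simp only [ha_def, Fintype.sum_bool, ← two_mul, ← Finset.mul_sum]
    linarith
  set N := eLpNorm (fun x => ‖φ x‖ₑ * v x) p volume with hN
  set T := ∑ n, (∫ x in E n, φ x) ^ 2 with hT
  set F := fun (ε : ι → ℤˣ) (δ : M × Bool → ℤˣ) => testFun φ E r a ε δ with hF
  have hFi : ∀ ε δ, Integrable (F ε δ) volume := fun ε δ => integrable_testFun hφ hE hrm hr ha ε δ
  -- The upper bound holds for every choice of signs; only the lower bound needs averaging.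
  have hup : ∀ ε δ, ∫⁻ ξ, u ξ ^ ρ * ‖𝓕 (F ε δ) ξ‖ₑ ^ ρ ≤ (C * (3 * N)) ^ ρ := by
    intro ε δ
    have h1 : eLpNorm (fun x => ‖F ε δ x‖ₑ * v x) p volume ≤ 3 * N := by
      have := eLpNorm_le_nnreal_smul_eLpNorm_of_ae_le_mul' (μ := volume) (c := 3)
        (f := fun x => ‖F ε δ x‖ₑ * v x) (g := fun x => ‖φ x‖ₑ * v x)
        (Filter.Eventually.of_forall fun x => ?_) p
      · simpa [ENNReal.smul_def] using this
      · simp only [enorm_eq_self]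
        rw [← mul_assoc]
        gcongr
        have := norm_testFun_le (φ := φ) hEd hr ha ε δ x
        rw [← ofReal_norm, ← ofReal_norm]
        calc ENNReal.ofReal ‖F ε δ x‖ ≤ ENNReal.ofReal (3 * ‖φ x‖) := ENNReal.ofReal_le_ofReal this
          _ = _ := by rw [ENNReal.ofReal_mul (by norm_num)]; simp
    have h2 := (h (F ε δ) (hFi ε δ) (h1.trans_lt (ENNReal.mul_lt_top (by simp) hφv))).trans
      (mul_le_mul_right h1 _)
    rw [eLpNorm_eq_lintegral_rpow_enorm_toReal hq0.ne' hqtop, ← hρ] at h2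
    simp only [enorm_eq_self] at h2
    have h3 := ENNReal.rpow_le_rpow h2 hρ0.le
    rw [← ENNReal.rpow_mul, one_div, inv_mul_cancel₀ hρ0.ne', ENNReal.rpow_one] at h3
    simpa only [ENNReal.mul_rpow_of_nonneg _ _ hρ0.le] using h3
  set k1 : ℝ≥0∞ := (Fintype.card (ι → ℤˣ) : ℝ≥0∞) with hk1
  set k2 : ℝ≥0∞ := (Fintype.card (M × Bool → ℤˣ) : ℝ≥0∞) with hk2
  have hlow : ∀ m, ∀ ξ ∈ D m, k1 * k2 *
      ENNReal.ofReal (momentConst ρ * (α m ^ 2 * T) ^ (ρ / 2))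
        ≤ ∑ ε, ∑ δ, ‖𝓕 (F ε δ) ξ‖ₑ ^ ρ := by
    intro m ξ hξ
    obtain ⟨s, hs⟩ := exists_trigPart_lower h0 hφ hE x₀ ξ (η m) fun n x hxE => hx n m x hxE ξ hξ
    have hmain := sum_signs_rpow_lower (μ := volume)
      (κ := fun n => (E n).indicator (fun x => (φ x : ℂ) * fourierPhase ξ x))
      (fun n => (integrable_mul_fourierPhase hφ.ofReal ξ).indicator (hE n)) hrm hr ha hρ0 hρ2
      (T := T) ?_ (m, s) ?_
    · have h5 := ENNReal.ofReal_le_ofReal hmain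
      rw [ENNReal.ofReal_mul (by positivity), ENNReal.ofReal_mul (by positivity),
        ENNReal.ofReal_natCast, ENNReal.ofReal_natCast] at h5
      refine h5.trans_eq ?_
      rw [ENNReal.ofReal_sum_of_nonneg fun _ _ => Finset.sum_nonneg fun _ _ => by positivity]
      refine Finset.sum_congr rfl fun ε _ => ?_
      rw [ENNReal.ofReal_sum_of_nonneg fun _ _ => by positivity]
      refine Finset.sum_congr rfl fun δ _ => ?_
      rw [hF, fourier_testFun hφ hE hrm hr ha, ← ofReal_norm,
        ENNReal.ofReal_rpow_of_nonneg (norm_nonneg _) hρ0.le]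
    · refine (Finset.sum_congr rfl fun n _ => ?_).le
      have : ∀ x, ‖(E n).indicator (fun x => (φ x : ℂ) * fourierPhase ξ x) x‖
          = (E n).indicator φ x := by
        intro x
        by_cases hxE : x ∈ E n
        · rw [indicator_of_mem hxE, indicator_of_mem hxE, norm_mul, norm_fourierPhase, mul_one,
            Complex.norm_real, Real.norm_of_nonneg (h0 x)]
        · rw [indicator_of_notMem hxE, indicator_of_notMem hxE, norm_zero]
      simp only [this]
      rw [integral_indicator (hE n)]
    · refine hs.trans_eq (Finset.sum_congr rfl fun n _ => ?_)
      congr 2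
      rw [← integral_indicator (hE n)]
      congr 1
      funext x
      by_cases hxE : x ∈ E n
      · simp only [indicator_of_mem hxE, hr_def]
      · simp only [indicator_of_notMem hxE, zero_mul]
  have hFm : ∀ ε δ, AEMeasurable (fun ξ => u ξ ^ ρ * ‖𝓕 (F ε δ) ξ‖ₑ ^ ρ) volume := by
    intro ε δ
    have hc : Continuous (𝓕 (F ε δ)) := VectorFourier.fourierIntegral_continuous
      Real.continuous_fourierChar (by exact continuous_inner) (hFi ε δ)
    exact (hu.pow_const ρ).mul (hc.measurable.enorm.pow_const ρ).aemeasurable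
  have hchain : k1 * k2 * ∑ m, (∫⁻ ξ in D m, u ξ ^ ρ) * ENNReal.ofReal (momentConst ρ *
        (α m ^ 2 * T) ^ (ρ / 2)) ≤ k1 * k2 * (C * (3 * N)) ^ ρ := by
    calc _ = ∑ m, ∫⁻ ξ in D m, u ξ ^ ρ *
            (k1 * k2 * ENNReal.ofReal (momentConst ρ * (α m ^ 2 * T) ^ (ρ / 2))) := by
          rw [Finset.mul_sum]
          refine Finset.sum_congr rfl fun m _ => ?_
          rw [lintegral_mul_const'' _ (hu.restrict.pow_const ρ)]
          ring
      _ ≤ ∑ m, ∫⁻ ξ in D m, ∑ ε, ∑ δ, u ξ ^ ρ * ‖𝓕 (F ε δ) ξ‖ₑ ^ ρ := by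
          refine Finset.sum_le_sum fun m _ => setLIntegral_mono' (hD m) fun ξ hξ => ?_
          simp only [← Finset.mul_sum]
          gcongr
          exact hlow m ξ hξ
      _ = ∫⁻ ξ in ⋃ m ∈ Finset.univ, D m, ∑ ε, ∑ δ, u ξ ^ ρ * ‖𝓕 (F ε δ) ξ‖ₑ ^ ρ := by
          rw [lintegral_biUnion_finset (fun i _ j _ hij => hDd hij) fun m _ => hD m]
      _ ≤ ∫⁻ ξ, ∑ ε, ∑ δ, u ξ ^ ρ * ‖𝓕 (F ε δ) ξ‖ₑ ^ ρ := setLIntegral_le_lintegral _ _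
      _ = ∑ ε, ∑ δ, ∫⁻ ξ, u ξ ^ ρ * ‖𝓕 (F ε δ) ξ‖ₑ ^ ρ := by
          rw [lintegral_finsetSum' _ fun ε _ => Finset.aemeasurable_fun_sum _ fun δ _ => hFm ε δ]
          refine Finset.sum_congr rfl fun ε _ => ?_
          rw [lintegral_finsetSum' _ fun δ _ => hFm ε δ]
      _ ≤ ∑ ε : ι → ℤˣ, ∑ δ : M × Bool → ℤˣ, (C * (3 * N)) ^ ρ :=
          Finset.sum_le_sum fun ε _ => Finset.sum_le_sum fun δ _ => hup ε δ
      _ = _ := by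
          simp only [Finset.sum_const, Finset.card_univ, nsmul_eq_mul]
          rw [hk1, hk2]
          ring
  refine (ENNReal.mul_le_mul_iff_right ?_ ?_).1 hchain
  · rw [hk1, hk2]
    exact mul_ne_zero (Nat.cast_ne_zero.2 Fintype.card_ne_zero)
      (Nat.cast_ne_zero.2 Fintype.card_ne_zero)
  · rw [hk1, hk2]
    exact ENNReal.mul_ne_top (ENNReal.natCast_ne_top _) (ENNReal.natCast_ne_top _)

end

/-! ### Exponents and extremal choices -/

/-- The relations between `p`, `p'` and `p♯`, in terms of `σ = 1 / p`. -/
lemma exponent_relations {p : ℝ≥0∞} (hp : 2 < p) {σ : ℝ} (hσ : σ = (p⁻¹).toReal) :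
    0 ≤ σ ∧ σ < 1 / 2 ∧ 1 ≤ conjExp p ∧ 0 < sharpExp p ∧ 1 / sharpExp p = 1 / 2 - σ ∧
      2 * (σ * (sharpExp p / conjExp p - 1)) + 2 = sharpExp p / conjExp p ∧
      0 ≤ σ * (sharpExp p / conjExp p - 1) ∧ 1 / conjExp p = 1 - σ := by
  have h0 : 0 ≤ σ := hσ ▸ ENNReal.toReal_nonneg
  have h1 : σ < 1 / 2 := by
    have h2 : p⁻¹ < 2⁻¹ := ENNReal.inv_lt_inv.2 hp
    have h3 := (ENNReal.toReal_lt_toReal h2.ne_top (by simp)).2 h2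
    rw [← hσ] at h3
    simpa using h3
  have hc : conjExp p = (1 - σ)⁻¹ := by rw [conjExp, hσ]
  have hs : sharpExp p = (1 / 2 - σ)⁻¹ := by
    rw [sharpExp, ← hσ, abs_of_pos (by linarith)]
  have hg : sharpExp p / conjExp p = (1 - σ) / (1 / 2 - σ) := by
    rw [hc, hs]; field_simp
  have h2 : 0 < 1 / 2 - σ := by linarith
  have h3 : 0 < 1 - σ := by linarith
  have h5 : (1 - σ) / (1 / 2 - σ) * (1 / 2 - σ) = 1 - σ := div_mul_cancel₀ _ h2.ne'
  have h6 : 1 ≤ (1 - σ) / (1 / 2 - σ) := by rw [le_div_iff₀ h2]; linarith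
  refine ⟨h0, h1, ?_, ?_, ?_, ?_, ?_, ?_⟩
  · rw [hc]
    exact (one_le_inv₀ h3).2 (by linarith)
  · rw [hs]; positivity
  · rw [hs]; simp
  · rw [hg]
    linarith
  · rw [hg]
    exact mul_nonneg h0 (by linarith)
  · rw [hc]; simp

/-- The relations between `q` and `q♯`. -/
lemma exponent_relations_lt_two {q : ℝ≥0∞} (hq0 : 0 < q) (hq2 : q < 2) {ρ : ℝ}
    (hρ : ρ = q.toReal) :
    0 < ρ ∧ ρ < 2 ∧ 0 < sharpExp q ∧ 1 / sharpExp q = 1 / ρ - 1 / 2 ∧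
      1 + sharpExp q / ρ * (ρ / 2) = sharpExp q / ρ := by
  have hqtop : q ≠ ∞ := (hq2.trans ENNReal.ofNat_lt_top).ne
  have hρ0 : 0 < ρ := hρ ▸ ENNReal.toReal_pos hq0.ne' hqtop
  have hρ2 : ρ < 2 := by
    have := (ENNReal.toReal_lt_toReal hqtop ENNReal.ofNat_ne_top).2 hq2
    rw [hρ]
    simpa using this
  have h2 : (1 / 2 : ℝ) < ρ⁻¹ := by
    rw [one_div, inv_lt_inv₀ (by norm_num) hρ0]; exact hρ2
  have hs : sharpExp q = (ρ⁻¹ - 1 / 2)⁻¹ := by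
    rw [sharpExp, ENNReal.toReal_inv, ← hρ, abs_sub_comm, abs_of_pos (by linarith)]
  have h3 : 0 < ρ⁻¹ - 1 / 2 := by linarith
  refine ⟨hρ0, hρ2, ?_, ?_, ?_⟩
  · rw [hs]; positivity
  · rw [hs]; simp
  · rw [hs]
    have h4 : 0 < 2 - ρ := by linarith
    have : ρ⁻¹ - 1 / 2 = (2 - ρ) / (2 * ρ) := by field_simp
    rw [this]
    field_simp
    ring

lemma sum_indicator_of_mem {X ι R : Type*} [Fintype ι] [AddCommMonoid R]
    {E : ι → Set X} (hd : Pairwise (Function.onFun Disjoint E)) (f : ι → X → R)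
    {n : ι} {x : X} (hn : x ∈ E n) : ∑ m, (E m).indicator (f m) x = f n x := by
  classical
  rw [Finset.sum_eq_single n]
  · rw [indicator_of_mem hn]
  · intro m _ hm
    exact indicator_of_notMem (fun hxm => (Set.disjoint_left.1 (hd hm) hxm) hn) _
  · simp

lemma rpow_sum_indicator {X ι : Type*} [Fintype ι]
    {E : ι → Set X} (hd : Pairwise (Function.onFun Disjoint E)) (f : ι → X → ℝ≥0∞)
    {P : ℝ} (hP : 0 < P) (x : X) :
    (∑ m, (E m).indicator (f m) x) ^ P = ∑ m, (E m).indicator (fun x => f m x ^ P) x := by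
  by_cases h : ∃ n, x ∈ E n
  · obtain ⟨n, hn⟩ := h
    rw [sum_indicator_of_mem hd f hn, sum_indicator_of_mem hd _ hn]
  · push Not at h
    rw [Finset.sum_eq_zero fun n _ => indicator_of_notMem (h n) _,
      Finset.sum_eq_zero fun n _ => indicator_of_notMem (h n) _, ENNReal.zero_rpow_of_pos hP]

/-- The weighted norm of the extremal function `∑ W_n^β 1_{E_n} w^{p'}`. -/
lemma eLpNorm_extremal_le {X ι : Type*} [MeasurableSpace X] {μ : Measure X} [Fintype ι]
    {p : ℝ≥0∞} (hp : 2 < p) {w v : X → ℝ≥0∞} (hw : AEMeasurable w μ)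
    (hwv : ∀ x, w x * v x ≤ 1) {E : ι → Set X} (hE : ∀ n, MeasurableSet (E n))
    (hEd : Pairwise (Function.onFun Disjoint E)) {W : ι → ℝ≥0∞}
    (hW : ∀ n, W n = ∫⁻ x in E n, w x ^ conjExp p ∂μ)
    {σ : ℝ} (hσ : σ = (p⁻¹).toReal) {β : ℝ} (hβ : β = σ * (sharpExp p / conjExp p - 1)) :
    eLpNorm (fun x => (∑ n, (E n).indicator (fun x => W n ^ β * w x ^ conjExp p) x) * v x) p μ
      ≤ (∑ n, W n ^ (sharpExp p / conjExp p)) ^ σ := by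
  obtain ⟨h0, h1, hc1, hs0, hs, hrel, hβ0, hc⟩ := exponent_relations hp hσ
  have hpt : ∀ x, (∑ n, (E n).indicator (fun x => W n ^ β * w x ^ conjExp p) x) * v x
      ≤ ∑ n, (E n).indicator (fun x => W n ^ β * w x ^ (conjExp p - 1)) x := by
    intro x
    rw [Finset.sum_mul]
    refine Finset.sum_le_sum fun n _ => ?_
    by_cases hx : x ∈ E n
    · rw [indicator_of_mem hx, indicator_of_mem hx]
      have : w x ^ conjExp p = w x ^ (conjExp p - 1) * w x := by
        conv_lhs => rw [show conjExp p = (conjExp p - 1) + 1 by ring]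
        rw [ENNReal.rpow_add_of_nonneg _ _ (by linarith) zero_le_one, ENNReal.rpow_one]
      rw [this, mul_assoc, mul_assoc]
      calc W n ^ β * (w x ^ (conjExp p - 1) * (w x * v x))
          ≤ W n ^ β * (w x ^ (conjExp p - 1) * 1) := by gcongr; exact hwv x
        _ = _ := by rw [mul_one]
    · rw [indicator_of_notMem hx, zero_mul]; exact zero_le
  refine (eLpNorm_mono_enorm (g := fun x =>
    ∑ n, (E n).indicator (fun x => W n ^ β * w x ^ (conjExp p - 1)) x) fun x => ?_).trans ?_
  · simpa only [enorm_eq_self] using hpt x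
  -- At `p = ∞` one has `p' = 1` and `β = 0`, and the majorant is the indicator of the union of the
  -- `E n`.
  by_cases hpt : p = ∞
  · subst hpt
    have hσ0 : σ = 0 := by simp [hσ]
    have hcc : conjExp ∞ = 1 := by simp [conjExp]
    rw [hσ0, ENNReal.rpow_zero, hcc, hβ, hσ0]
    simp only [zero_mul, ENNReal.rpow_zero, sub_self, mul_one]
    rw [eLpNorm_exponent_top]
    refine essSup_le_of_ae_le _ (Filter.Eventually.of_forall fun x => ?_)
    simp only [enorm_eq_self]
    by_cases h : ∃ n, x ∈ E n
    · obtain ⟨n, hn⟩ := h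
      exact (sum_indicator_of_mem hEd (fun _ _ => (1 : ℝ≥0∞)) hn).le
    · push Not at h
      rw [Finset.sum_eq_zero fun n _ => indicator_of_notMem (h n) _]
      exact zero_le
  · have hP0 : 0 < p.toReal := ENNReal.toReal_pos (by
      rintro rfl; exact absurd hp (by simp)) hpt
    have hσP : σ = 1 / p.toReal := by rw [hσ, ENNReal.toReal_inv, one_div]
    have e1 : (conjExp p - 1) * p.toReal = conjExp p := by
      have h3 : conjExp p = (1 - σ)⁻¹ := by rw [← hc]; simp
      have h4 : 0 < 1 - σ := by linarith
      rw [h3]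
      have h5 : σ * p.toReal = 1 := by rw [hσP]; field_simp
      field_simp
      linarith
    have e2 : β * p.toReal + 1 = sharpExp p / conjExp p := by
      rw [hβ, hσP]
      field_simp
      ring
    rw [eLpNorm_eq_lintegral_rpow_enorm_toReal (by rintro rfl; exact absurd hp (by simp)) hpt]
    simp only [enorm_eq_self]
    rw [← hσP]
    refine ENNReal.rpow_le_rpow (le_of_eq ?_) h0
    simp only [rpow_sum_indicator hEd _ hP0]
    rw [lintegral_finsetSum']
    · refine Finset.sum_congr rfl fun n _ => ?_
      rw [lintegral_indicator (hE n)]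
      simp only [ENNReal.mul_rpow_of_nonneg _ _ hP0.le, ← ENNReal.rpow_mul, e1]
      rw [lintegral_const_mul'' _ (hw.restrict.pow_const _), ← hW, ← e2,
        ENNReal.rpow_add_of_nonneg _ _ (mul_nonneg (hβ ▸ hβ0) hP0.le) zero_le_one, ENNReal.rpow_one]
    · intro n _
      exact AEMeasurable.indicator (((hw.pow_const _).const_mul _).pow_const _) (hE n)

/-- Take `ρ`-th roots and divide by `m^(1/ρ) A^σ`; this division is why `A` and `m` must be neither
0 nor `∞`. -/
lemma rpow_mul_rpow_le_of_moment_le {A B m C : ℝ≥0∞} (hA0 : A ≠ 0) (hA : A ≠ ∞)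
    (hm0 : m ≠ 0) (hm : m ≠ ∞) {ρ σ : ℝ} (hρ : 0 < ρ)
    (h : m * (A ^ (ρ / 2) * B ^ (1 - ρ / 2)) ≤ (C * (3 * A ^ σ)) ^ ρ) :
    A ^ (1 / 2 - σ) * B ^ (1 / ρ - 1 / 2) ≤ 3 * m ^ (-(1 / ρ)) * C := by
  have h1 := ENNReal.rpow_le_rpow h (z := 1 / ρ) (by positivity)
  rw [ENNReal.mul_rpow_of_nonneg _ _ (by positivity),
    ENNReal.mul_rpow_of_nonneg _ _ (by positivity), ← ENNReal.rpow_mul, ← ENNReal.rpow_mul,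
    ← ENNReal.rpow_mul, mul_one_div_cancel hρ.ne', ENNReal.rpow_one,
    show ρ / 2 * (1 / ρ) = 1 / 2 by field_simp,
    show (1 - ρ / 2) * (1 / ρ) = 1 / ρ - 1 / 2 by field_simp] at h1
  calc A ^ (1 / 2 - σ) * B ^ (1 / ρ - 1 / 2)
      = (m ^ (-(1 / ρ)) * m ^ (1 / ρ)) * (A ^ (1 / 2 : ℝ) * A ^ (-σ)) * B ^ (1 / ρ - 1 / 2) := by
        rw [← ENNReal.rpow_add _ _ hm0 hm, neg_add_cancel, ENNReal.rpow_zero, one_mul,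
          ← ENNReal.rpow_add _ _ hA0 hA, sub_eq_add_neg]
    _ = m ^ (-(1 / ρ)) * A ^ (-σ) * (m ^ (1 / ρ) * (A ^ (1 / 2 : ℝ) * B ^ (1 / ρ - 1 / 2))) := by ring
    _ ≤ m ^ (-(1 / ρ)) * A ^ (-σ) * (C * (3 * A ^ σ)) := mul_le_mul_right h1 _
    _ = 3 * m ^ (-(1 / ρ)) * C * (A ^ σ * A ^ (-σ)) := by ring
    _ = 3 * m ^ (-(1 / ρ)) * C := by
        rw [← ENNReal.rpow_add _ _ hA0 hA, add_neg_cancel, ENNReal.rpow_zero, mul_one]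

/-- The constant in the amalgam inequality for finite families. -/
def familyConst (ρ : ℝ) : ℝ≥0 := 3 * (momentConst ρ).toNNReal ^ (-(1 / ρ))

lemma coe_familyConst (ρ : ℝ) :
    (familyConst ρ : ℝ≥0∞) = 3 * ENNReal.ofReal (momentConst ρ) ^ (-(1 / ρ)) := by
  rw [familyConst, ENNReal.coe_mul, ENNReal.ofReal,
    ENNReal.coe_rpow_of_ne_zero (Real.toNNReal_pos.2 (momentConst_pos ρ)).ne']
  simp

/-- The test inequality is optimised on both sides. Taking `φ = W_n^β w^{p'}` on `E n` makes both
`T` and the `p`-th power of the weighted norm (for finite `p`) comparable to the same sum `A`;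
`α_m²` is proportional to `U_m^{q♯/q}`. The weight `w` only satisfies `w v ≤ 1`, so that truncations
of `v⁻¹` are admissible. -/
lemma WeightedFourierIneq.finite_family_le {d : ℕ} {p q : ℝ≥0∞} (hq0 : 0 < q) (hq2 : q < 2)
    (hp : 2 < p) {u v w : EuclideanSpace ℝ (Fin d) → ℝ≥0∞} (hu : AEMeasurable u volume)
    (hw : AEMeasurable w volume) (hwtop : ∀ x, w x ≠ ∞) (hwv : ∀ x, w x * v x ≤ 1) {C : ℝ≥0}
    (h : WeightedFourierIneq p q u v C) {ι M : Type*} [Fintype ι] [Fintype M]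
    {E : ι → Set (EuclideanSpace ℝ (Fin d))} (hE : ∀ n, MeasurableSet (E n))
    (hEd : Pairwise (Function.onFun Disjoint E))
    {D : M → Set (EuclideanSpace ℝ (Fin d))} (hD : ∀ m, MeasurableSet (D m))
    (hDd : Pairwise (Function.onFun Disjoint D))
    (x₀ : ι → EuclideanSpace ℝ (Fin d)) (η : M → EuclideanSpace ℝ (Fin d))
    (hx : ∀ n m, ∀ x ∈ E n, ∀ ξ ∈ D m, |inner ℝ (x - x₀ n) (ξ - η m)| ≤ 1 / 6)
    (hW : ∀ n, ∫⁻ x in E n, w x ^ conjExp p ≠ ∞) (hU : ∀ m, ∫⁻ ξ in D m, u ξ ^ q.toReal ≠ ∞) :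
    (∑ n, (∫⁻ x in E n, w x ^ conjExp p) ^ (sharpExp p / conjExp p)) ^ (1 / sharpExp p) *
      (∑ m, (∫⁻ ξ in D m, u ξ ^ q.toReal) ^ (sharpExp q / q.toReal)) ^ (1 / sharpExp q)
      ≤ familyConst q.toReal * C := by
  obtain ⟨σ, hσ⟩ : ∃ σ, σ = (p⁻¹).toReal := ⟨_, rfl⟩
  obtain ⟨h0, h1, hc1, hs0, hs, hrel, hβ0, hc⟩ := exponent_relations hp hσ
  obtain ⟨hρ0, hρ2, hqs0, hqs, hωrel⟩ := exponent_relations_lt_two hq0 hq2 rfl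
  have hc0 : 0 < conjExp p := by linarith
  set ρ := q.toReal with hρ
  set γ := sharpExp p / conjExp p with hγ
  set ω := sharpExp q / ρ with hω
  have hω0 : 0 < ω := by positivity
  have hγ0 : 0 < γ := by positivity
  obtain ⟨β, hβ⟩ : ∃ β, β = σ * (γ - 1) := ⟨_, rfl⟩
  rw [← hβ] at hβ0 hrel
  obtain ⟨W, hWdef⟩ : ∃ W : ι → ℝ≥0∞, ∀ n, W n = ∫⁻ x in E n, w x ^ conjExp p := ⟨_, fun _ => rfl⟩
  obtain ⟨U, hUdef⟩ : ∃ U : M → ℝ≥0∞, ∀ m, U m = ∫⁻ ξ in D m, u ξ ^ ρ := ⟨_, fun _ => rfl⟩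
  simp only [← hWdef] at hW ⊢
  simp only [← hUdef] at hU ⊢
  obtain ⟨A, hA⟩ : ∃ A, A = ∑ n, W n ^ γ := ⟨_, rfl⟩
  obtain ⟨B, hB⟩ : ∃ B, B = ∑ m, U m ^ ω := ⟨_, rfl⟩
  rw [← hA, ← hB]
  by_cases hA0 : A = 0
  · rw [hA0, ENNReal.zero_rpow_of_pos (by positivity), zero_mul]; exact zero_le
  by_cases hB0 : B = 0
  · rw [hB0, ENNReal.zero_rpow_of_pos (by positivity), mul_zero]; exact zero_le
  have hWγ : ∀ n, W n ^ γ ≠ ∞ := fun n => ENNReal.rpow_ne_top_of_nonneg hγ0.le (hW n)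
  have hUω : ∀ m, U m ^ ω ≠ ∞ := fun m => ENNReal.rpow_ne_top_of_nonneg hω0.le (hU m)
  have hAtop : A ≠ ∞ := hA ▸ ENNReal.sum_ne_top.2 fun n _ => hWγ n
  have hBtop : B ≠ ∞ := hB ▸ ENNReal.sum_ne_top.2 fun m _ => hUω m
  set φe : EuclideanSpace ℝ (Fin d) → ℝ≥0∞ :=
    fun x => ∑ n, (E n).indicator (fun x => W n ^ β * w x ^ conjExp p) x with hφe
  have hφem : AEMeasurable φe volume := Finset.aemeasurable_fun_sum _ fun n _ =>
    AEMeasurable.indicator ((hw.pow_const _).const_mul _) (hE n)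
  have hφtop : ∀ x, φe x ≠ ∞ := by
    intro x
    refine ENNReal.sum_ne_top.2 fun n _ => ?_
    by_cases hxE : x ∈ E n
    · rw [indicator_of_mem hxE]
      exact ENNReal.mul_ne_top (ENNReal.rpow_ne_top_of_nonneg hβ0 (hW n))
        (ENNReal.rpow_ne_top_of_nonneg hc0.le (hwtop x))
    · rw [indicator_of_notMem hxE]; exact ENNReal.zero_ne_top
  have hφE : ∀ n, ∫⁻ x in E n, φe x = W n ^ (β + 1) := by
    intro n
    calc ∫⁻ x in E n, φe x = ∫⁻ x in E n, W n ^ β * w x ^ conjExp p :=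
          setLIntegral_congr_fun (hE n) fun x hxE => sum_indicator_of_mem hEd _ hxE
      _ = _ := by
          rw [lintegral_const_mul'' _ (hw.restrict.pow_const _), ← hWdef,
            ENNReal.rpow_add_of_nonneg _ _ hβ0 zero_le_one, ENNReal.rpow_one]
  have hφint : ∫⁻ x, φe x ≠ ∞ := by
    rw [hφe, lintegral_finsetSum' _ fun n _ =>
      AEMeasurable.indicator ((hw.pow_const _).const_mul _) (hE n)]
    refine ENNReal.sum_ne_top.2 fun n _ => ?_
    rw [lintegral_indicator (hE n), lintegral_const_mul'' _ (hw.restrict.pow_const _), ← hWdef]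
    exact ENNReal.mul_ne_top (ENNReal.rpow_ne_top_of_nonneg hβ0 (hW n)) (hW n)
  have hφenorm : ∀ x, ‖(φe x).toReal‖ₑ = φe x := fun x => by
    rw [Real.enorm_of_nonneg ENNReal.toReal_nonneg, ENNReal.ofReal_toReal (hφtop x)]
  have hN : eLpNorm (fun x => ‖(φe x).toReal‖ₑ * v x) p volume ≤ A ^ σ := by
    simp only [hφenorm]
    rw [hA]
    exact eLpNorm_extremal_le hp hw hwv hE hEd hWdef hσ hβ
  have hNtop : A ^ σ < ∞ := (ENNReal.rpow_ne_top_of_nonneg h0 hAtop).lt_top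
  -- The extremal weights `α_m² = U_m^ω / B`, normalised to total mass 1.
  have hα : ∑ m, ((U m ^ ω / B).toReal ^ (1 / 2 : ℝ)) ^ 2 = 1 := by
    have : ∀ m, ((U m ^ ω / B).toReal ^ (1 / 2 : ℝ)) ^ 2 = (U m ^ ω / B).toReal := fun m => by
      rw [← Real.rpow_natCast, ← Real.rpow_mul ENNReal.toReal_nonneg]; norm_num
    simp only [this]
    rw [← ENNReal.toReal_sum fun m _ => ENNReal.div_ne_top (hUω m) hB0]
    simp only [div_eq_mul_inv]
    rw [← Finset.sum_mul, ← hB, ENNReal.mul_inv_cancel hB0 hBtop, ENNReal.toReal_one]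
  have hmain := h.sum_lintegral_le hq0 hq2 hu (φ := fun x => (φe x).toReal)
    (fun x => ENNReal.toReal_nonneg) (integrable_toReal_of_lintegral_ne_top hφem hφint)
    (hN.trans_lt hNtop) hE hEd hD hDd x₀ η hx hα.le
  -- The exponent `β` satisfies `2 (β + 1) = γ`, so the squared masses of `φ` add up to `A`.
  have hT : ∑ n, (∫ x in E n, (φe x).toReal) ^ 2 = A.toReal := by
    rw [hA, ENNReal.toReal_sum fun n _ => hWγ n]
    refine Finset.sum_congr rfl fun n _ => ?_
    rw [integral_toReal hφem.restrict (Filter.Eventually.of_forall fun x => (hφtop x).lt_top),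
      hφE, ← ENNReal.toReal_pow, ← ENNReal.rpow_natCast, ← ENNReal.rpow_mul]
    congr 2
    push_cast
    linarith
  have hterm : ∀ m, U m * ENNReal.ofReal (momentConst ρ *
      (((U m ^ ω / B).toReal ^ (1 / 2 : ℝ)) ^ 2 * A.toReal) ^ (ρ / 2))
      = ENNReal.ofReal (momentConst ρ) * (A ^ (ρ / 2) * B ^ (-(ρ / 2))) * U m ^ ω := by
    intro m
    have e1 : ((U m ^ ω / B).toReal ^ (1 / 2 : ℝ)) ^ 2 = (U m ^ ω / B).toReal := by
      rw [← Real.rpow_natCast, ← Real.rpow_mul ENNReal.toReal_nonneg]; norm_num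
    have hρ2' : 0 ≤ ρ / 2 := by positivity
    rw [e1, ENNReal.ofReal_mul (momentConst_pos ρ).le, ← ENNReal.toReal_mul,
      ← ENNReal.ofReal_rpow_of_nonneg ENNReal.toReal_nonneg hρ2', ENNReal.ofReal_toReal
        (ENNReal.mul_ne_top (ENNReal.div_ne_top (hUω m) hB0) hAtop),
      ENNReal.mul_rpow_of_nonneg _ _ hρ2', div_eq_mul_inv, ENNReal.mul_rpow_of_nonneg _ _ hρ2',
      ENNReal.inv_rpow, ← ENNReal.rpow_neg, ← ENNReal.rpow_mul]
    -- Since `1 + ω ρ / 2 = ω`, each term is again a multiple of `U_m^ω`, and the sum over `m`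
    -- yields `B`.
    have e2 : U m ^ ω = U m * U m ^ (ω * (ρ / 2)) := by
      conv_lhs => rw [← hωrel]
      rw [ENNReal.rpow_add_of_nonneg _ _ zero_le_one (by positivity), ENNReal.rpow_one]
    conv_rhs => rw [e2]
    ring
  rw [← hρ] at hmain
  simp only [← hUdef, hT, hterm] at hmain
  rw [← Finset.mul_sum, ← hB] at hmain
  have hB1 : B ^ (1 - ρ / 2) = B ^ (-(ρ / 2)) * B := by
    rw [show 1 - ρ / 2 = -(ρ / 2) + 1 by ring, ENNReal.rpow_add _ _ hB0 hBtop, ENNReal.rpow_one]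
  have hfin := rpow_mul_rpow_le_of_moment_le (m := ENNReal.ofReal (momentConst ρ)) (C := C)
    (σ := σ) hA0 hAtop (ENNReal.ofReal_pos.2 (momentConst_pos ρ)).ne' ENNReal.ofReal_ne_top
    hρ0 (by
      rw [hB1]
      calc _ = ENNReal.ofReal (momentConst ρ) * (A ^ (ρ / 2) * B ^ (-(ρ / 2))) * B := by ring
        _ ≤ _ := hmain
        _ ≤ _ := by gcongr)
  rw [hs, hqs, coe_familyConst]
  exact hfin

/-! ### Half-open lattice cells -/

section cell
variable {d : ℕ}

/-- The half-open cube `s n + [0, s)^d`. -/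
def latticeCell (s : ℝ) (n : Fin d → ℤ) : Set (EuclideanSpace ℝ (Fin d)) :=
  {x | ∀ i, s * n i ≤ x i ∧ x i < s * (n i + 1)}

/-- The lattice point `s n`. -/
def latticePoint (s : ℝ) (n : Fin d → ℤ) : EuclideanSpace ℝ (Fin d) :=
  WithLp.toLp 2 fun i => s * n i

lemma latticeCell_eq_preimage (s : ℝ) (n : Fin d → ℤ) :
    latticeCell s n = WithLp.ofLp ⁻¹' (univ.pi fun i => Ico (s * n i) (s * (n i + 1))) := by
  ext x
  simp [latticeCell]

lemma measurableSet_latticeCell (s : ℝ) (n : Fin d → ℤ) : MeasurableSet (latticeCell s n) := by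
  rw [latticeCell_eq_preimage]
  exact (PiLp.volume_preserving_ofLp (Fin d)).measurable
    (MeasurableSet.univ_pi fun i => measurableSet_Ico)

lemma volume_latticeCell (s : ℝ) (n : Fin d → ℤ) :
    volume (latticeCell s n) = ENNReal.ofReal s ^ d := by
  rw [latticeCell_eq_preimage, (PiLp.volume_preserving_ofLp (Fin d)).measure_preimage
    (MeasurableSet.univ_pi fun i => measurableSet_Ico).nullMeasurableSet, volume_pi_pi]
  have : ∀ i, s * ((n i : ℝ) + 1) - s * n i = s := fun i => by ring
  simp [Real.volume_Ico, this]

lemma eq_floor_of_mem_latticeCell {s : ℝ} (hs : 0 < s) {n : Fin d → ℤ}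
    {x : EuclideanSpace ℝ (Fin d)} (hx : x ∈ latticeCell s n) : n = fun i => ⌊x i / s⌋ := by
  funext i
  symm
  rw [Int.floor_eq_iff, le_div_iff₀ hs, div_lt_iff₀ hs]
  have := hx i
  constructor <;> linarith

lemma mem_latticeCell_floor {s : ℝ} (hs : 0 < s) (x : EuclideanSpace ℝ (Fin d)) :
    x ∈ latticeCell s fun i => ⌊x i / s⌋ := by
  intro i
  have h1 := Int.floor_le (x i / s)
  have h2 := Int.lt_floor_add_one (x i / s)
  rw [le_div_iff₀ hs] at h1
  rw [div_lt_iff₀ hs] at h2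
  constructor <;> linarith

lemma pairwise_disjoint_latticeCell {s : ℝ} (hs : 0 < s) :
    Pairwise (Function.onFun Disjoint (latticeCell (d := d) s)) := by
  intro n m hnm
  refine Set.disjoint_left.2 fun x hx hx' => hnm ?_
  rw [eq_floor_of_mem_latticeCell hs hx, eq_floor_of_mem_latticeCell hs hx']

lemma abs_sub_latticePoint_le {s : ℝ} {n : Fin d → ℤ} {x : EuclideanSpace ℝ (Fin d)}
    (hx : x ∈ latticeCell s n) (i : Fin d) : |(x - latticePoint s n) i| ≤ s := by
  have := hx i
  have e : (x - latticePoint s n) i = x i - s * n i := rfl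
  rw [e, abs_le]
  constructor <;> linarith

lemma abs_inner_sub_latticePoint_le {s s' : ℝ} {n m : Fin d → ℤ}
    {x ξ : EuclideanSpace ℝ (Fin d)} (hx : x ∈ latticeCell s n) (hξ : ξ ∈ latticeCell s' m) :
    |inner ℝ (x - latticePoint s n) (ξ - latticePoint s' m)| ≤ d * (s * s') := by
  rw [PiLp.inner_apply]
  refine (Finset.abs_sum_le_sum_abs _ _).trans ?_
  have : ∀ i ∈ (Finset.univ : Finset (Fin d)), |inner ℝ ((x - latticePoint s n) i)
      ((ξ - latticePoint s' m) i)| ≤ s * s' := by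
    intro i _
    have h1 := abs_sub_latticePoint_le hx i
    have h2 := abs_sub_latticePoint_le hξ i
    exact (abs_real_inner_le_norm _ _).trans
      (mul_le_mul h1 h2 (abs_nonneg _) ((abs_nonneg _).trans h1))
  refine (Finset.sum_le_card_nsmul _ _ _ this).trans_eq ?_
  simp

end cell

/-! ### From finite families to full lattices -/

lemma ENNReal.iSup_rpow {ι : Sort*} (f : ι → ℝ≥0∞) {a : ℝ} (ha : 0 < a) :
    (⨆ i, f i) ^ a = ⨆ i, f i ^ a :=
  (ENNReal.orderIsoRpow a ha).map_iSup f

lemma lintegral_rpow_eq_iSup_min {X : Type*} [MeasurableSpace X] {μ : Measure X} {w : X → ℝ≥0∞}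
    (hw : AEMeasurable w μ) {a : ℝ} (ha : 0 < a) :
    ∫⁻ x, w x ^ a ∂μ = ⨆ R : ℕ, ∫⁻ x, min (w x) R ^ a ∂μ := by
  rw [← lintegral_iSup']
  · refine lintegral_congr fun x => ?_
    rw [← ENNReal.iSup_rpow _ ha]
    congr 1
    have := inf_iSup_eq (w x) (fun R : ℕ => (R : ℝ≥0∞))
    rw [ENNReal.iSup_natCast, inf_top_eq] at this
    exact this
  · exact fun R => (hw.min aemeasurable_const).pow_const a
  · refine Filter.Eventually.of_forall fun x R R' hR => ?_
    have : (R : ℝ≥0∞) ≤ R' := by exact_mod_cast hR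
    exact ENNReal.rpow_le_rpow (min_le_min_left _ this) ha.le

/-- Monotone convergence in the truncation height and in the set of cells. It reduces the lattice
inequality to finite sums of finite integrals, as `finite_family_le` requires. -/
lemma rpow_tsum_lintegral_eq_iSup {X ι : Type*} [MeasurableSpace X] {μ : Measure X}
    {w : X → ℝ≥0∞} (hw : AEMeasurable w μ) (E : ι → Set X) {a γ b : ℝ} (ha : 0 < a) (hγ : 0 < γ)
    (hb : 0 < b) :
    (∑' n, (∫⁻ x in E n, w x ^ a ∂μ) ^ γ) ^ b
      = ⨆ (N : Finset ι) (R : ℕ), (∑ n ∈ N, (∫⁻ x in E n, min (w x) R ^ a ∂μ) ^ γ) ^ b := by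
  rw [ENNReal.tsum_eq_iSup_sum, ENNReal.iSup_rpow _ hb]
  refine iSup_congr fun N => ?_
  rw [← ENNReal.iSup_rpow _ hb, ← ENNReal.finsetSum_iSup_of_monotone]
  · congr 1
    refine Finset.sum_congr rfl fun n _ => ?_
    rw [lintegral_rpow_eq_iSup_min hw.restrict ha, ENNReal.iSup_rpow _ hγ]
  · intro n R R' hR
    have : (R : ℝ≥0∞) ≤ R' := by exact_mod_cast hR
    exact ENNReal.rpow_le_rpow (lintegral_mono fun x =>
      ENNReal.rpow_le_rpow (min_le_min_left _ this) ha.le) hγ.le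

lemma WeightedFourierIneq.mono_left {d : ℕ} {p q : ℝ≥0∞}
    {u u' v : EuclideanSpace ℝ (Fin d) → ℝ≥0∞} {C : ℝ≥0} (h : WeightedFourierIneq p q u v C)
    (hu : ∀ x, u' x ≤ u x) : WeightedFourierIneq p q u' v C := fun f hf hfv =>
  (eLpNorm_mono_enorm fun ξ => by
    simp only [enorm_eq_self]
    exact mul_le_mul_left (hu ξ) _).trans (h f hf hfv)

/-- The amalgam inequality for two dual lattices of small half-open cubes. -/
lemma WeightedFourierIneq.latticeCell_le {d : ℕ} {p q : ℝ≥0∞} (hq0 : 0 < q) (hq2 : q < 2)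
    (hp : 2 < p) {u v : EuclideanSpace ℝ (Fin d) → ℝ≥0∞} (hu : AEMeasurable u volume)
    (hv : AEMeasurable v volume) {C : ℝ≥0} (h : WeightedFourierIneq p q u v C)
    {s s' : ℝ} (hs : 0 < s) (hs' : 0 < s') (hss : d * (s * s') ≤ 1 / 6) :
    (∑' n : Fin d → ℤ, (∫⁻ x in latticeCell s n, (v x)⁻¹ ^ conjExp p) ^
        (sharpExp p / conjExp p)) ^ (1 / sharpExp p) *
      (∑' m : Fin d → ℤ, (∫⁻ ξ in latticeCell s' m, u ξ ^ q.toReal) ^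
        (sharpExp q / q.toReal)) ^ (1 / sharpExp q)
      ≤ familyConst q.toReal * C := by
  obtain ⟨-, -, hc1, hs0, -⟩ := exponent_relations hp rfl
  obtain ⟨hρ0, -, hqs0, -⟩ := exponent_relations_lt_two hq0 hq2 rfl
  have hc0 : 0 < conjExp p := by linarith
  have hv' : AEMeasurable (fun x => (v x)⁻¹) volume := hv.inv
  rw [rpow_tsum_lintegral_eq_iSup hv' _ hc0 (by positivity) (by positivity),
    rpow_tsum_lintegral_eq_iSup hu _ hρ0 (by positivity) (by positivity)]
  simp only [ENNReal.iSup_mul, ENNReal.mul_iSup]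
  refine iSup_le fun M => iSup_le fun R' => iSup_le fun N => iSup_le fun R => ?_
  have hfin : ∀ {r : ℝ} (S : ℕ) (w : EuclideanSpace ℝ (Fin d) → ℝ≥0∞) {a : ℝ} (_ : 0 < a)
      (n : Fin d → ℤ), ∫⁻ x in latticeCell r n, min (w x) S ^ a ≠ ∞ := by
    intro r S w a ha n
    refine ne_top_of_le_ne_top (b := ∫⁻ x in latticeCell r n, (S : ℝ≥0∞) ^ a) ?_ ?_
    · rw [lintegral_const, Measure.restrict_apply_univ, volume_latticeCell]
      exact ENNReal.mul_ne_top (ENNReal.rpow_ne_top_of_nonneg ha.le (ENNReal.natCast_ne_top _))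
        (ENNReal.pow_ne_top ENNReal.ofReal_ne_top)
    · exact lintegral_mono fun x => ENNReal.rpow_le_rpow (min_le_right _ _) ha.le
  have hmain := (h.mono_left (u' := fun x => min (u x) R') fun x => min_le_left _ _).finite_family_le
    hq0 hq2 hp (w := fun x => min (v x)⁻¹ R) (hu.min aemeasurable_const)
    (hv'.min aemeasurable_const) (fun x => ne_top_of_le_ne_top (ENNReal.natCast_ne_top R)
      (min_le_right _ _)) (fun x => ?_) (ι := N) (M := M) (E := fun n => latticeCell s n)
    (fun n => measurableSet_latticeCell _ _)
    (fun i j hij => pairwise_disjoint_latticeCell hs fun hh => hij (Subtype.ext hh))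
    (D := fun m => latticeCell s' m)
    (fun n => measurableSet_latticeCell _ _)
    (fun i j hij => pairwise_disjoint_latticeCell hs' fun hh => hij (Subtype.ext hh))
    (fun n => latticePoint s n) (fun m => latticePoint s' m)
    (fun n m x hx ξ hξ => (abs_inner_sub_latticePoint_le hx hξ).trans hss)
    (fun n => hfin R _ hc0 _) (fun m => hfin R' _ hρ0 _)
  · rw [← Finset.sum_coe_sort N, ← Finset.sum_coe_sort M]
    exact hmain
  · exact (mul_le_mul_left (min_le_left _ _) _).trans (ENNReal.inv_mul_le_one _)

/-! ### Comparing coarse cubes with small cells -/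

section grid

/-- Each `x k` is at most `(∑ x^γ)^(1/γ)`. The constant is crude, but the argument covers all `γ >
0`. -/
lemma ENNReal.sum_rpow_le_card_rpow_mul_sum {ι : Type*} (K : Finset ι) (x : ι → ℝ≥0∞) {γ : ℝ}
    (hγ : 0 < γ) : (∑ k ∈ K, x k) ^ γ ≤ (K.card : ℝ≥0∞) ^ γ * ∑ k ∈ K, x k ^ γ := by
  have h : ∀ k ∈ K, x k ≤ (∑ k ∈ K, x k ^ γ) ^ (1 / γ) := by
    intro k hk
    rw [one_div, ENNReal.le_rpow_inv_iff hγ]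
    exact Finset.single_le_sum (f := fun k => x k ^ γ) (fun _ _ => zero_le) hk
  calc (∑ k ∈ K, x k) ^ γ ≤ (K.card • (∑ k ∈ K, x k ^ γ) ^ (1 / γ)) ^ γ := by
        gcongr
        exact Finset.sum_le_card_nsmul _ _ _ h
    _ = _ := by
        rw [nsmul_eq_mul, ENNReal.mul_rpow_of_nonneg _ _ hγ.le, ← ENNReal.rpow_mul,
          one_div_mul_cancel hγ.ne', ENNReal.rpow_one]

/-- The offsets of the small cubes that cover a cube of the coarse grid. -/
def cellOffsets (d L : ℕ) : Finset (Fin d → ℤ) :=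
  Fintype.piFinset fun _ => Finset.Icc (-(L : ℤ)) L

lemma gridCube_subset_iUnion_latticeCell {d L : ℕ} (hL : 0 < L) {s : ℝ} (hs : 0 < s)
    (n : Fin d → ℤ) :
    gridCube s n ⊆ ⋃ k ∈ cellOffsets d L, latticeCell (s / L) fun i => L * n i + k i := by
  intro x hx
  have hL' : (0 : ℝ) < L := by exact_mod_cast hL
  have hsL : 0 < s / L := by positivity
  have hfl := mem_latticeCell_floor hsL x
  rw [mem_iUnion₂]
  refine ⟨fun i => ⌊x i / (s / L)⌋ - L * n i, ?_, ?_⟩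
  · rw [cellOffsets, Fintype.mem_piFinset]
    intro i
    have h1 := abs_le.1 (hx i)
    have h2 : x i / (s / L) = L * n i + (x i - s * n i) * L / s := by field_simp; ring
    have h3 : -(L : ℝ) ≤ (x i - s * n i) * L / s := by
      rw [le_div_iff₀ hs]; nlinarith
    have h4 : (x i - s * n i) * L / s ≤ L := by
      rw [div_le_iff₀ hs]; nlinarith
    rw [Finset.mem_Icc]
    constructor
    · rw [le_sub_iff_add_le, Int.le_floor, h2]
      push_cast
      linarith
    · have : (⌊x i / (s / L)⌋ : ℝ) ≤ L * n i + L := (Int.floor_le _).trans (by rw [h2]; linarith)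
      have h5 : ⌊x i / (s / L)⌋ ≤ L * n i + L := by exact_mod_cast this
      linarith
  · simpa using hfl

/-- Every coarse cube is covered by cells with a fixed set of offsets `k`. For fixed `k` the map `n
↦ L n + k` is injective, so each offset contributes at most the full sum over cells. -/
lemma tsum_gridCube_le {d L : ℕ} (hL : 0 < L) {s : ℝ} (hs : 0 < s) {γ : ℝ} (hγ : 0 < γ)
    (g : EuclideanSpace ℝ (Fin d) → ℝ≥0∞) :
    ∑' n : Fin d → ℤ, (∫⁻ x in gridCube s n, g x) ^ γ
      ≤ ((cellOffsets d L).card : ℝ≥0∞) ^ γ * (cellOffsets d L).card *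
        ∑' n : Fin d → ℤ, (∫⁻ x in latticeCell (s / L) n, g x) ^ γ := by
  have hsL : 0 < s / L := by positivity
  have h1 : ∀ n : Fin d → ℤ, (∫⁻ x in gridCube s n, g x) ^ γ ≤
      ((cellOffsets d L).card : ℝ≥0∞) ^ γ * ∑ k ∈ cellOffsets d L,
        (∫⁻ x in latticeCell (s / L) fun i => L * n i + k i, g x) ^ γ := by
    intro n
    refine le_trans ?_ (ENNReal.sum_rpow_le_card_rpow_mul_sum _ _ hγ)
    gcongr
    calc ∫⁻ x in gridCube s n, g x
        ≤ ∫⁻ x in ⋃ k ∈ cellOffsets d L, latticeCell (s / L) fun i => L * n i + k i, g x :=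
          lintegral_mono_set (gridCube_subset_iUnion_latticeCell hL hs n)
      _ = _ := by
        refine lintegral_biUnion_finset (fun k _ k' _ hk => ?_)
          (fun k _ => measurableSet_latticeCell _ _) g
        refine pairwise_disjoint_latticeCell hsL fun h => hk (funext fun i => ?_)
        have := congrFun h i
        simpa using this
  refine (ENNReal.tsum_le_tsum h1).trans ?_
  rw [ENNReal.tsum_mul_left, mul_assoc, Summable.tsum_finsetSum fun _ _ => ENNReal.summable]
  gcongr
  rw [← nsmul_eq_mul]
  refine Finset.sum_le_card_nsmul _ _ _ fun k _ => ?_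
  refine ENNReal.tsum_comp_le_tsum_of_injective (f := fun (n : Fin d → ℤ) i => L * n i + k i)
    (fun n m h => funext fun i => ?_)
    (fun j => (∫⁻ x in latticeCell (s / L) j, g x) ^ γ)
  have h2 := congrFun h i
  simp only [add_left_inj] at h2
  exact mul_left_cancel₀ (by exact_mod_cast hL.ne') h2

end grid

/-! ### Polar coordinates -/

section polar
variable {E : Type*} [NormedAddCommGroup E] [NormedSpace ℝ E] [MeasurableSpace E] [BorelSpace E]
  [FiniteDimensional ℝ E] [Nontrivial E]

lemma lintegral_fun_norm_addHaar (μ : Measure E) [μ.IsAddHaarMeasure] {g : ℝ → ℝ≥0∞}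
    (hg : Measurable g) :
    ∫⁻ x, g ‖x‖ ∂μ = Module.finrank ℝ E * μ (Metric.ball 0 1) *
      ∫⁻ y in Ioi (0 : ℝ), g y * ENNReal.ofReal (y ^ (Module.finrank ℝ E - 1)) := by
  calc ∫⁻ x, g ‖x‖ ∂μ = ∫⁻ x : ({0}ᶜ : Set E), g ‖x.1‖ ∂(μ.comap (↑)) := by
        rw [lintegral_subtype_comap (measurableSet_singleton _).compl fun x => g ‖x‖,
          restrict_compl_singleton]
    _ = ∫⁻ x, 1 * g x.2 ∂μ.toSphere.prod (.volumeIoiPow (Module.finrank ℝ E - 1)) := by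
        rw [← μ.measurePreserving_homeomorphUnitSphereProd.lintegral_comp_emb
          (Homeomorph.measurableEmbedding _)]
        simp
    _ = μ.toSphere univ * ∫⁻ x : Ioi (0 : ℝ), g x ∂.volumeIoiPow (Module.finrank ℝ E - 1) := by
        rw [lintegral_prod_mul (f := fun _ => 1) (g := fun x : Ioi (0 : ℝ) => g x)
          aemeasurable_const (hg.comp measurable_subtype_coe).aemeasurable, lintegral_one]
    _ = _ := by
        rw [μ.toSphere_apply_univ, Measure.volumeIoiPow,
          lintegral_withDensity_eq_lintegral_mul _
            (f := fun r : Ioi (0 : ℝ) => ENNReal.ofReal (r.1 ^ (Module.finrank ℝ E - 1)))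
            (ENNReal.measurable_ofReal.comp (measurable_subtype_coe.pow_const _))
            (g := fun x : Ioi (0 : ℝ) => g x) (hg.comp measurable_subtype_coe)]
        congr 1
        rw [← lintegral_subtype_comap measurableSet_Ioi
          fun y => g y * ENNReal.ofReal (y ^ (Module.finrank ℝ E - 1))]
        refine lintegral_congr fun x => ?_
        simp [mul_comm]

end polar

/-! ### Tails of radially decreasing weights -/

section radial
variable {d : ℕ}

lemma norm_le_of_forall_abs_le {x : EuclideanSpace ℝ (Fin d)} {c : ℝ} (hc : 0 ≤ c)
    (h : ∀ i, |x i| ≤ c) : ‖x‖ ≤ d * c := by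
  rw [EuclideanSpace.norm_eq]
  refine Real.sqrt_le_iff.2 ⟨by positivity, ?_⟩
  calc ∑ i, ‖x i‖ ^ 2 ≤ ∑ _i : Fin d, c ^ 2 := by
        refine Finset.sum_le_sum fun i _ => ?_
        rw [Real.norm_eq_abs]
        exact pow_le_pow_left₀ (abs_nonneg _) (h i) 2
    _ = d * c ^ 2 := by simp
    _ ≤ (d * c) ^ 2 := by
        have : (d : ℝ) ≤ (d : ℝ) ^ 2 := by exact_mod_cast Nat.le_self_pow two_ne_zero d
        nlinarith [sq_nonneg c]

lemma norm_sub_le_of_mem_latticeCell {h : ℝ} (hh : 0 ≤ h) {m : Fin d → ℤ}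
    {x z : EuclideanSpace ℝ (Fin d)} (hx : x ∈ latticeCell h m) (hz : z ∈ latticeCell h m) :
    ‖z - x‖ ≤ d * h := by
  refine norm_le_of_forall_abs_le hh fun i => ?_
  have h1 := hx i
  have h2 := hz i
  rw [PiLp.sub_apply, abs_le]
  constructor <;> linarith

/-- For `x` far from the origin there is a nearby lattice cube whose points have norm between
`s / 2` and `‖x‖`. -/
lemma exists_latticeCell_norm_le {s h : ℝ} (hs : 0 < s) (hh : 0 < h) (hsh : 4 * (d * h) ≤ s)
    {x : EuclideanSpace ℝ (Fin d)} (hx : s < ‖x‖) :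
    ∃ m, x ∈ Metric.closedBall (latticePoint h m) (2 * (d * h)) ∧
      ∀ z ∈ latticeCell h m, s / 2 ≤ ‖z‖ ∧ ‖z‖ ≤ ‖x‖ := by
  have hx0 : 0 < ‖x‖ := hs.trans hx
  have hdh : 0 ≤ d * h := by positivity
  -- Moving `x` towards the origin by `d h`, a bound for the diameter of a cell, puts the whole cell
  -- of `x'` inside the ball of radius `‖x‖`. Its points have norm at least `‖x‖ - 2 d h ≥ s / 2`.
  set x' : EuclideanSpace ℝ (Fin d) := (1 - d * h / ‖x‖) • x with hx'
  have hfrac : d * h / ‖x‖ ≤ 1 := by rw [div_le_one hx0]; linarith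
  have hnx' : ‖x'‖ = ‖x‖ - d * h := by
    rw [hx', norm_smul, Real.norm_of_nonneg (by linarith)]
    field_simp
  have hdist : ‖x - x'‖ = d * h := by
    have : x - x' = (d * h / ‖x‖) • x := by rw [hx', sub_smul, one_smul]; abel
    rw [this, norm_smul, Real.norm_of_nonneg (by positivity)]
    field_simp
  have hmem := mem_latticeCell_floor hh x'
  refine ⟨fun i => ⌊x' i / h⌋, ?_, fun z hz => ?_⟩
  · have hp : latticePoint h (fun i => ⌊x' i / h⌋) ∈ latticeCell h (fun i => ⌊x' i / h⌋) := by
      intro i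
      refine ⟨le_rfl, ?_⟩
      change h * _ < _
      linarith
    have := norm_sub_le_of_mem_latticeCell hh.le hp hmem
    rw [mem_closedBall_iff_norm]
    calc _ = ‖(x - x') + (x' - latticePoint h (fun i => ⌊x' i / h⌋))‖ := by congr 1; abel
      _ ≤ ‖x - x'‖ + ‖x' - latticePoint h (fun i => ⌊x' i / h⌋)‖ := norm_add_le _ _
      _ ≤ _ := by linarith
  · have h1 := norm_sub_le_of_mem_latticeCell hh.le hmem hz
    have h2 : ‖z‖ ≤ ‖x'‖ + ‖z - x'‖ := by
      calc ‖z‖ = ‖x' + (z - x')‖ := by congr 1; abel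
        _ ≤ _ := norm_add_le _ _
    have h3 : ‖x'‖ ≤ ‖z‖ + ‖z - x'‖ := by
      calc ‖x'‖ = ‖z - (z - x')‖ := by congr 1; abel
        _ ≤ _ := norm_sub_le _ _
    constructor <;> linarith

/-- The tail integral of a radially decreasing weight is controlled by a sum over lattice cubes. -/
lemma lintegral_tail_le_tsum_latticeCell (hd : 1 ≤ d) {w : EuclideanSpace ℝ (Fin d) → ℝ≥0∞}
    {w₀ : ℝ → ℝ≥0∞} {s h : ℝ} (hs : 0 < s) (hh : 0 < h) (hsh : 4 * (d * h) ≤ s)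
    (hw : RadialAntitoneBeyond (s / 2) w w₀) {α β γ : ℝ} (hα : 0 < α) (hγ : 0 < γ)
    (hαγ : α * γ = β) (hβγ : γ = 1 + β / 2) :
    (∫⁻ y in Ioi s, w₀ y ^ β * ENNReal.ofReal (y ^ (d - 1))) * ENNReal.ofReal h ^ (d * (β / 2))
      ≤ ENNReal.ofReal (2 * d) ^ d *
        ∑' m : Fin d → ℤ, (∫⁻ z in latticeCell h m, w z ^ α) ^ γ := by
  have hβ : 0 < β := hαγ ▸ mul_pos hα hγ
  have : Nonempty (Fin d) := ⟨⟨0, hd⟩⟩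
  set H := ENNReal.ofReal h ^ d with hH
  have hH0 : H ≠ 0 := pow_ne_zero _ (ENNReal.ofReal_pos.2 hh).ne'
  have hHtop : H ≠ ∞ := ENNReal.pow_ne_top ENNReal.ofReal_ne_top
  set S := fun m : Fin d → ℤ => (∫⁻ z in latticeCell h m, w z ^ α) ^ γ with hS
  set B := fun m : Fin d → ℤ =>
    Metric.closedBall (latticePoint (d := d) h m) (2 * (d * h)) with hB
  -- Replacing `y` by `max y s` gives a function antitone on all of `ℝ`, hence measurable, without
  -- changing the values beyond `s`.
  set g : ℝ → ℝ≥0∞ := (Ioi s).indicator fun y => w₀ (max y s) ^ β with hg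
  have hgm : Measurable g := by
    refine Measurable.indicator (Measurable.pow_const ?_ _) measurableSet_Ioi
    refine Antitone.measurable fun y z hyz => hw.2 ?_ ?_ (max_le_max_right _ hyz)
    · exact mem_Ici.2 (le_max_of_le_right (by linarith))
    · exact mem_Ici.2 (le_max_of_le_right (by linarith))
  -- On the nearby cell the weight is at least `w₀ ‖x‖`, so the integral over that cell dominates `H
  -- w₀ ‖x‖^α`. Integrating in `x` then costs only the volume of the ball `B m`.
  have hpt : ∀ x : EuclideanSpace ℝ (Fin d),
      H ^ γ * g ‖x‖ ≤ ∑' m, (B m).indicator (fun _ => S m) x := by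
    intro x
    by_cases hx : s < ‖x‖
    · obtain ⟨m, hm, hcell⟩ := exists_latticeCell_norm_le hs hh hsh hx
      refine le_trans ?_ (ENNReal.le_tsum m)
      rw [indicator_of_mem hm, hg, indicator_of_mem (mem_Ioi.2 hx), max_eq_left hx.le, hS, ← hαγ,
        ENNReal.rpow_mul, ← ENNReal.mul_rpow_of_nonneg _ _ hγ.le]
      refine ENNReal.rpow_le_rpow ?_ hγ.le
      calc H * w₀ ‖x‖ ^ α = ∫⁻ _ in latticeCell h m, w₀ ‖x‖ ^ α := by
            rw [lintegral_const, Measure.restrict_apply_univ, volume_latticeCell, mul_comm]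
        _ ≤ _ := by
            refine setLIntegral_mono' (measurableSet_latticeCell _ _) fun z hz => ?_
            obtain ⟨h1, h2⟩ := hcell z hz
            rw [hw.1 z h1]
            exact ENNReal.rpow_le_rpow (hw.2 h1 (h1.trans h2) h2) hα.le
    · rw [hg, indicator_of_notMem (by simpa using hx), mul_zero]
      exact zero_le
  have hint := lintegral_mono (μ := volume) hpt
  have hHγtop : H ^ γ ≠ ∞ := ENNReal.rpow_ne_top_of_nonneg hγ.le hHtop
  rw [lintegral_const_mul' _ _ hHγtop, lintegral_tsum fun m =>
    (measurable_const.indicator Metric.isClosed_closedBall.measurableSet).aemeasurable,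
    lintegral_fun_norm_addHaar volume hgm] at hint
  have hvol : ∀ m, ∫⁻ x, (B m).indicator (fun _ => S m) x
      = ENNReal.ofReal (2 * d) ^ d * H * volume (Metric.ball (0 : EuclideanSpace ℝ (Fin d)) 1)
        * S m := by
    intro m
    rw [lintegral_indicator_const Metric.isClosed_closedBall.measurableSet,
      Measure.addHaar_closedBall _ _ (by positivity), finrank_euclideanSpace_fin, hH,
      ← mul_assoc 2 (d : ℝ) h, ENNReal.ofReal_pow (by positivity),
      ENNReal.ofReal_mul (p := 2 * (d : ℝ)) (by positivity), mul_pow]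
    ring
  rw [tsum_congr hvol] at hint
  rw [ENNReal.tsum_mul_left, finrank_euclideanSpace_fin] at hint
  have hX : ∫⁻ y in Ioi (0 : ℝ), g y * ENNReal.ofReal (y ^ (d - 1))
      = ∫⁻ y in Ioi s, w₀ y ^ β * ENNReal.ofReal (y ^ (d - 1)) := by
    rw [← lintegral_indicator measurableSet_Ioi, ← lintegral_indicator measurableSet_Ioi]
    refine lintegral_congr fun y => ?_
    by_cases hy : s < y
    · rw [indicator_of_mem (mem_Ioi.2 (hs.trans hy)), indicator_of_mem (mem_Ioi.2 hy), hg,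
        indicator_of_mem (mem_Ioi.2 hy), max_eq_left hy.le]
    · rw [indicator_of_notMem (by simpa using hy : y ∉ Ioi s)]
      have hg0 : g y = 0 := by rw [hg, indicator_of_notMem (by simpa using hy : y ∉ Ioi s)]
      simp [indicator, hg0]
  rw [hX] at hint
  set X := ∫⁻ y in Ioi s, w₀ y ^ β * ENNReal.ofReal (y ^ (d - 1))
  set b := volume (Metric.ball (0 : EuclideanSpace ℝ (Fin d)) 1) with hb
  have hb0 : b ≠ 0 := (Metric.measure_ball_pos _ _ one_pos).ne'
  have hbtop : b ≠ ∞ := measure_ball_lt_top.ne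
  -- One factor `H` cancels against the volume of `B m`; what is left is the power of `h` in the
  -- statement.
  have hHγ : H ^ γ = H * ENNReal.ofReal h ^ (d * (β / 2)) := by
    rw [hβγ, ENNReal.rpow_add_of_nonneg _ _ zero_le_one (by positivity), ENNReal.rpow_one, hH,
      ENNReal.rpow_mul, ENNReal.rpow_natCast]
  have hd1 : (1 : ℝ≥0∞) ≤ d := by exact_mod_cast hd
  refine (ENNReal.mul_le_mul_iff_right (mul_ne_zero hH0 hb0) (ENNReal.mul_ne_top hHtop hbtop)).1 ?_
  calc H * b * (X * ENNReal.ofReal h ^ (d * (β / 2))) = H ^ γ * (1 * b * X) := by rw [hHγ]; ring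
    _ ≤ H ^ γ * (d * b * X) := by gcongr
    _ ≤ _ := hint
    _ = _ := by ring

end radial

/-! ### Assembling both estimates -/

section conclusion
variable {d : ℕ}

lemma cubeSum_neg_eq (s a b : ℝ) (w : EuclideanSpace ℝ (Fin d) → ℝ≥0∞) :
    cubeSum s (-a) b w = cubeSum s a b fun x => (w x)⁻¹ := by
  simp only [cubeSum, abs_neg, ENNReal.inv_rpow, ENNReal.rpow_neg]

lemma radialTail_neg_eq (s a : ℝ) (w₀ : ℝ → ℝ≥0∞) :
    radialTail d s (-a) w₀ = radialTail d s a fun y => (w₀ y)⁻¹ := by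
  simp only [radialTail, abs_neg, ENNReal.inv_rpow, ENNReal.rpow_neg]

/-- The sum over small half-open cubes that corresponds to `cubeSum`. -/
def cellSum (s a b : ℝ) (w : EuclideanSpace ℝ (Fin d) → ℝ≥0∞) : ℝ≥0∞ :=
  (∑' n : Fin d → ℤ, (∫⁻ x in latticeCell s n, w x ^ a) ^ (b / a)) ^ (1 / b)

lemma exists_cubeSum_le (hd : 1 ≤ d) {a b : ℝ} (ha : 0 < a) (hb : 0 < b) :
    ∃ K : ℝ≥0, ∀ s : ℝ, 0 < s → ∀ w : EuclideanSpace ℝ (Fin d) → ℝ≥0∞,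
      cubeSum s a b w ≤ K * cellSum (s / ((6 * d : ℕ) : ℝ)) a b w := by
  have hγ : 0 < b / a := by positivity
  set c : ℝ≥0∞ := ((cellOffsets d (6 * d)).card : ℝ≥0∞) ^ (b / a) * (cellOffsets d (6 * d)).card
    with hc
  have hctop : c ^ (1 / b) ≠ ∞ := ENNReal.rpow_ne_top_of_nonneg (by positivity)
    (ENNReal.mul_ne_top (ENNReal.rpow_ne_top_of_nonneg hγ.le (ENNReal.natCast_ne_top _))
      (ENNReal.natCast_ne_top _))
  refine ⟨(c ^ (1 / b)).toNNReal, fun s hs w => ?_⟩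
  rw [ENNReal.coe_toNNReal hctop, cubeSum, cellSum, abs_of_pos ha,
    ← ENNReal.mul_rpow_of_nonneg _ _ (by positivity)]
  exact ENNReal.rpow_le_rpow (tsum_gridCube_le (by omega) hs hγ _) (by positivity)

/-- The relation `1/a = 1/2 + 1/b` is common to `(p', p♯)` and `(q, q♯)`, so this serves both
weights. The factor of order `s^(d/2)` is harmless: the scales `1/t` and `t` are used together. -/
lemma exists_radialTail_mul_le (hd : 1 ≤ d) {a b : ℝ} (ha : 0 < a) (hb : 0 < b)
    (hab : 1 / a = 1 / 2 + 1 / b) :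
    ∃ K : ℝ≥0, ∀ s : ℝ, 0 < s → ∀ (w : EuclideanSpace ℝ (Fin d) → ℝ≥0∞) (w₀ : ℝ → ℝ≥0∞),
      RadialAntitoneBeyond (s / 2) w w₀ →
      radialTail d s b w₀ * ENNReal.ofReal (s / ((6 * d : ℕ) : ℝ)) ^ ((d : ℝ) / 2)
        ≤ K * cellSum (s / ((6 * d : ℕ) : ℝ)) a b w := by
  set c : ℝ≥0∞ := ENNReal.ofReal (2 * d) ^ d with hc
  have hctop : c ^ (1 / b) ≠ ∞ := ENNReal.rpow_ne_top_of_nonneg (by positivity)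
    (ENNReal.pow_ne_top ENNReal.ofReal_ne_top)
  have hd' : (1 : ℝ) ≤ d := by exact_mod_cast hd
  refine ⟨(c ^ (1 / b)).toNNReal, fun s hs w w₀ hw => ?_⟩
  have hh : 0 < s / ((6 * d : ℕ) : ℝ) := by
    push_cast
    positivity
  have h := lintegral_tail_le_tsum_latticeCell hd hs hh (by
    push_cast
    rw [show 4 * ((d : ℝ) * (s / (6 * d))) = 2 / 3 * s by field_simp; ring]
    linarith) hw ha (γ := b / a) (β := b) (by positivity) (by field_simp) (by
      calc b / a = b * (1 / a) := by ring
        _ = _ := by rw [hab]; field_simp; ring)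
  have h1 := ENNReal.rpow_le_rpow h (z := 1 / b) (by positivity)
  rw [ENNReal.mul_rpow_of_nonneg _ _ (by positivity), ENNReal.mul_rpow_of_nonneg _ _ (by positivity),
    ← ENNReal.rpow_mul (ENNReal.ofReal _), show (d : ℝ) * (b / 2) * (1 / b) = d / 2 by field_simp]
    at h1
  rw [ENNReal.coe_toNNReal hctop, radialTail, cellSum, abs_of_pos hb]
  exact h1

end conclusion

end

theorem lemma3p5 (d : ℕ) (hd : 1 ≤ d) (p q : ℝ≥0∞) (hq0 : 0 < q) (hq2 : q < 2) (hp : 2 < p) :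
    ∃ K : ℝ≥0, ∀ (u v : EuclideanSpace ℝ (Fin d) → ℝ≥0∞),
      AEMeasurable u volume → AEMeasurable v volume →
      ∀ C : ℝ≥0, WeightedFourierIneq p q u v C →
        ((⨆ (t : ℝ) (_ : 0 < t),
            cubeSum (1 / t) (-conjExp p) (sharpExp p) v * cubeSum t q.toReal (sharpExp q) u)
          ≤ K * C) ∧
        (∀ t : ℝ, 0 < t → ∀ u₀ v₀ : ℝ → ℝ≥0∞,
          RadialAntitoneBeyond (t / 2) u u₀ →
          RadialAntitoneBeyond (1 / (2 * t)) (fun x => (v x)⁻¹) (fun y => (v₀ y)⁻¹) →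
          radialTail d (1 / t) (-sharpExp p) v₀ * radialTail d t (sharpExp q) u₀ ≤ K * C) := by
  obtain ⟨-, -, hc1, hs0, hs, -, -, hc⟩ := exponent_relations hp rfl
  obtain ⟨hρ0, -, hqs0, hqs, -⟩ := exponent_relations_lt_two hq0 hq2 rfl
  have hc0 : 0 < conjExp p := by linarith
  obtain ⟨K₁, hK₁⟩ := exists_cubeSum_le hd hc0 hs0
  obtain ⟨K₂, hK₂⟩ := exists_cubeSum_le hd hρ0 hqs0
  obtain ⟨K₃, hK₃⟩ := exists_radialTail_mul_le hd hc0 hs0 (by rw [hc, hs]; ring)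
  obtain ⟨K₄, hK₄⟩ := exists_radialTail_mul_le hd hρ0 hqs0 (by rw [hqs]; ring)
  have hd' : (1 : ℝ) ≤ d := by exact_mod_cast hd
  have hL0 : (0 : ℝ) < ((6 * d : ℕ) : ℝ) := by
    push_cast
    linarith
  set L : ℝ := ((6 * d : ℕ) : ℝ) with hL
  have hLd : L = 6 * d := by rw [hL]; push_cast; ring
  set e : ℝ≥0∞ := ENNReal.ofReal (1 / L * (1 / L)) ^ ((d : ℝ) / 2) with he
  have hLpos : 0 < ENNReal.ofReal (1 / L * (1 / L)) := ENNReal.ofReal_pos.2 (by positivity)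
  have he0 : e ≠ 0 := (ENNReal.rpow_pos hLpos ENNReal.ofReal_ne_top).ne'
  have hetop : e ≠ ∞ := ENNReal.rpow_ne_top_of_nonneg (by positivity) ENNReal.ofReal_ne_top
  set F := familyConst q.toReal with hF
  refine ⟨max (K₁ * K₂ * F) (e⁻¹.toNNReal * (K₃ * K₄ * F)), fun u v hu hv C h => ?_⟩
  have hcell : ∀ t : ℝ, 0 < t →
      cellSum (1 / t / L) (conjExp p) (sharpExp p) (fun x => (v x)⁻¹) *
        cellSum (t / L) q.toReal (sharpExp q) u ≤ F * C := by
    intro t ht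
    refine h.latticeCell_le hq0 hq2 hp hu hv (by positivity) (by positivity) ?_
    -- With `L = 6 d` this equals `1 / (36 d)`, well below the `1/6` needed for the phases.
    have : d * (1 / t / L * (t / L)) = d / (L * L) := by field_simp
    rw [this, hLd, div_le_div_iff₀ (by positivity) (by norm_num)]
    nlinarith
  constructor
  · refine iSup₂_le fun t ht => ?_
    rw [cubeSum_neg_eq]
    calc _ ≤ (K₁ * cellSum (1 / t / L) (conjExp p) (sharpExp p) (fun x => (v x)⁻¹)) *
          (K₂ * cellSum (t / L) q.toReal (sharpExp q) u) :=
          mul_le_mul' (hK₁ _ (by positivity) _) (hK₂ _ ht _)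
      _ = K₁ * K₂ * (cellSum (1 / t / L) (conjExp p) (sharpExp p) (fun x => (v x)⁻¹) *
          cellSum (t / L) q.toReal (sharpExp q) u) := by ring
      _ ≤ K₁ * K₂ * (F * C) := mul_le_mul_right (hcell t ht) _
      _ = ((K₁ * K₂ * F : ℝ≥0) : ℝ≥0∞) * C := by push_cast; ring
      _ ≤ _ := by
        gcongr
        exact le_max_left _ _
  · intro t ht u₀ v₀ hu₀ hv₀
    rw [radialTail_neg_eq]
    have h1 := hK₃ (1 / t) (by positivity) (fun x => (v x)⁻¹) (fun y => (v₀ y)⁻¹) (by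
      convert hv₀ using 1; field_simp)
    have h2 := hK₄ t ht u u₀ hu₀
    -- The powers of `t` cancel, leaving a constant that depends only on `d`.
    have h3 : ENNReal.ofReal (1 / t / L) ^ ((d : ℝ) / 2) * ENNReal.ofReal (t / L) ^ ((d : ℝ) / 2)
        = e := by
      rw [← ENNReal.mul_rpow_of_nonneg _ _ (by positivity), ← ENNReal.ofReal_mul (by positivity), he]
      congr 2
      field_simp
    set X := radialTail d (1 / t) (sharpExp p) fun y => (v₀ y)⁻¹
    set Y := radialTail d t (sharpExp q) u₀
    calc X * Y = e⁻¹ * e * (X * Y) := by rw [ENNReal.inv_mul_cancel he0 hetop, one_mul]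
      _ = e⁻¹ * ((X * ENNReal.ofReal (1 / t / L) ^ ((d : ℝ) / 2)) *
          (Y * ENNReal.ofReal (t / L) ^ ((d : ℝ) / 2))) := by rw [← h3]; ring
      _ ≤ e⁻¹ * ((K₃ * cellSum (1 / t / L) (conjExp p) (sharpExp p) (fun x => (v x)⁻¹)) *
          (K₄ * cellSum (t / L) q.toReal (sharpExp q) u)) := by gcongr
      _ = e⁻¹ * (K₃ * K₄ * (cellSum (1 / t / L) (conjExp p) (sharpExp p) (fun x => (v x)⁻¹) *
          cellSum (t / L) q.toReal (sharpExp q) u)) := by ring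
      _ ≤ e⁻¹ * (K₃ * K₄ * (F * C)) := mul_le_mul_right (mul_le_mul_right (hcell t ht) _) _
      _ = ((e⁻¹.toNNReal * (K₃ * K₄ * F) : ℝ≥0) : ℝ≥0∞) * C := by
        push_cast
        rw [ENNReal.coe_toNNReal (ENNReal.inv_ne_top.2 he0)]
        ring
      _ ≤ _ := by
        gcongr
        exact le_max_right _ _
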